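/- Let $H$ be a commutative multiplicative monoid and let $z(H)=\{z\in H: xz=z\text{ for all }x\in H\}$. A weak ideal system on $H$ is a map $r:X\mapsto X_r$ on the power set of $H$ such that for all $X,Y\subseteq H$ and $c\in H$: $XH\cup z(H)\subseteq X_r$; if $X\subseteq Y_r$ then $X_r\subseteq Y_r$; and $cX_r\subseteq (cX)_r$. It is finitary if $X_r=\bigcup_{E\subseteq X,\,|E|<\infty}E_r$ for all $X$. An $r$-ideal is a set $I\subseteq H$ with $I_r=I$; it is proper if $I\ne H$. The system $r$ is modular if $(I\cup J)_r\cap N\subseteq (I\cup(J\cap N))_r$ for all $r$-ideals $I,J,N$ with $I\subseteq N$. A cancellative element $x\in H$ is regular if $(xA)_r=xA_r$ for all $A\subseteq H$. An $r$-ideal $I$ is regular if it contains a regular element; $r$-finitely generated if $I=E_r$ for some finite $E\subseteq I$; $r$-invertible if $(IJ)_r=yH$ for some $J\subseteq H$ and some regular $y$; prime if it is proper and $xy\in I$ implies $x\in I$ or $y\in I$; $r$-maximal if it is maximal among the proper $r$-ideals; radical if $x^n\in I$ with $n\ge 1$ implies $x\in I$. The radical of $I$ is $\{x\in H: x^n\in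 I\text{ for some }n\ge1\}$. The $r$-union of a family of $r$-ideals is the $r$-closure of its union, and the $r$-product of $J_1,\dots,J_n$ ($n\ge 0$) is $(J_1\cdots J_n)_r$, the empty $r$-product being $H$. $H$ is an $r$-Prüfer monoid if every regular $r$-finitely generated $r$-ideal is $r$-invertible. Let $\mathcal I_r(H)_{\rm reg}$ be the lattice of all regular $r$-ideals together with the bottom element $\emptyset_r$, ordered by inclusion and with multiplication $(I,J)\mapsto (IJ)_r$. Let $r\text{-}\max^{-1}(H)_{\rm reg}$ be the set of regular $r$-maximal $r$-ideals with the inverse topology, which has the sets $\{M: C\subseteq M\}$, $C$ a compact element of $\mathcal I_r(H)_{\rm reg}$, as a basis of open sets. For a topological space $X$, let $U_b(X)$ be the set of compactly supported upper semicontinuous functions $X\to\mathbb N_0$ under pointwise addition, with the order $f\le g$ iff $f(x)\ge g(x)$ for all $x$, together with an appended bottom element $b$ that satisfies $b+f=f+b=b$ for all $f$. **Theorem 8.4.** Let $r$ be a modular finitary weak ideal system on $H$ with $\emptyset_r\neq H$ such that each regular $r$-ideal of $H$ is an $r$-union of $r$-invertible $r$-ideals of $H$. Then the following are equivalent. 1.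 Every regular $r$-ideal of $H$ is an $r$-product of radical $r$-ideals. 2. Every regular prime $r$-ideal is $r$-maximal and each $r$-invertible $r$-ideal is an $r$-product of radical $r$-ideals. 3. Each regular prime $r$-ideal is $r$-maximal and contains an $r$-invertible radical $r$-ideal. 4. For each regular $r$-ideal $I$ there is exactly one finite sequence of proper radical $r$-ideals $J_1\subseteq\cdots\subseteq J_n$ ($n\ge 0$) with $r$-product $I$. 5. The radical of each regular $r$-finitely generated $r$-ideal is $r$-invertible. 6. $\mathcal I_r(H)_{\rm reg}$ and $U_b(r\text{-}\max^{-1}(H)_{\rm reg})$ are isomorphic as multiplicative lattices, i.e. there is an order isomorphism between them that carries $r$-multiplication to addition. 7. $H$ is an $r$-Prüfer monoid and the radical of every regular $r$-finitely generated $r$-ideal is $r$-finitely generated. -/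

import Mathlib

open scoped Pointwise

/-- The set `z(H)` of zero elements of `H`. -/
def zeroElements (H : Type*) [CommMonoid H] : Set H := {z | ∀ x : H, x * z = z}

/-- A weak ideal system on a commutative monoid `H`: a map `X ↦ X_r` on the power set of `H`,
written `r.cl X` below. -/
structure WeakIdealSystem (H : Type*) [CommMonoid H] where
  cl : Set H → Set H
  mul_univ_union_subset_cl : ∀ X : Set H, X * Set.univ ∪ zeroElements H ⊆ cl X
  cl_subset_cl_of_subset : ∀ X Y : Set H, X ⊆ cl Y → cl X ⊆ cl Y
  smul_cl_subset_cl_smul : ∀ (c : H) (X : Set H), c • cl X ⊆ cl (c • X)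

namespace WeakIdealSystem

variable {H : Type*} [CommMonoid H] (r : WeakIdealSystem H)

/-- `r` is finitary: every element of `X_r` lies in `E_r` for some finite `E ⊆ X`. -/
def Finitary : Prop :=
  ∀ X : Set H, r.cl X = ⋃ E ∈ {E : Set H | E ⊆ X ∧ E.Finite}, r.cl E

/-- `I` is an `r`-ideal. -/
def IsIdeal (I : Set H) : Prop := r.cl I = I

/-- `r` is modular. -/
def Modular : Prop :=
  ∀ I J N : Set H, r.IsIdeal I → r.IsIdeal J → r.IsIdeal N → I ⊆ N →
    r.cl (I ∪ J) ∩ N ⊆ r.cl (I ∪ (J ∩ N))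

/-- `x` is a regular element (with respect to `r`): `x` is cancellative and `(xA)_r = x A_r` for
all `A ⊆ H`. -/
def IsRegularElement (x : H) : Prop :=
  (∀ a b : H, x * a = x * b → a = b) ∧ ∀ A : Set H, r.cl (x • A) = x • r.cl A

/-- `I` contains a regular element. -/
def IsRegularSet (I : Set H) : Prop := ∃ x ∈ I, r.IsRegularElement x

/-- `I` is `r`-invertible: `(IJ)_r = yH` for some `J ⊆ H` and some regular `y`. -/
def IsInvertible (I : Set H) : Prop :=
  ∃ (J : Set H) (y : H), r.IsRegularElement y ∧ r.cl (I * J) = y • (Set.univ : Set H)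

/-- The `r`-ideal `I` is `r`-finitely generated. -/
def IsFinGen (I : Set H) : Prop := ∃ E : Set H, E.Finite ∧ E ⊆ I ∧ I = r.cl E

/-- `I` is the `r`-union of a family of `r`-invertible `r`-ideals. -/
def IsUnionOfInvertibles (I : Set H) : Prop :=
  ∃ 𝒥 : Set (Set H), (∀ J ∈ 𝒥, r.IsIdeal J ∧ r.IsInvertible J) ∧ I = r.cl (⋃₀ 𝒥)

/-- The radical of `I`. -/
def radical (I : Set H) : Set H := {x | ∃ n : ℕ, 0 < n ∧ x ^ n ∈ I}

/-- `I` is a radical `r`-ideal. -/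
def IsRadicalIdeal (I : Set H) : Prop :=
  r.IsIdeal I ∧ ∀ (n : ℕ) (x : H), 0 < n → x ^ n ∈ I → x ∈ I

/-- `P` is a prime `r`-ideal (in particular proper). -/
def IsPrimeIdeal (P : Set H) : Prop :=
  r.IsIdeal P ∧ P ≠ Set.univ ∧ ∀ x y : H, x * y ∈ P → x ∈ P ∨ y ∈ P

/-- `M` is `r`-maximal: maximal among the proper `r`-ideals. -/
def IsMaximalIdeal (M : Set H) : Prop :=
  Maximal (fun I : Set H => r.IsIdeal I ∧ I ≠ Set.univ) M

/-- The finite `r`-product `(J₁ ⋯ Jₙ)_r` of the list `[J₁, …, Jₙ]`; the empty `r`-product is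
`{1}_r = H`. -/
def product (l : List (Set H)) : Set H := r.cl l.prod

/-- `I` is an `r`-product of radical `r`-ideals. -/
def IsProductOfRadicals (I : Set H) : Prop :=
  ∃ l : List (Set H), (∀ J ∈ l, r.IsRadicalIdeal J) ∧ I = r.product l

/-- The list `[J₁, …, Jₙ]` consists of proper radical `r`-ideals, `J₁ ⊆ ⋯ ⊆ Jₙ`, and its
`r`-product is `I`. -/
def IsRadicalChainFactorization (I : Set H) (l : List (Set H)) : Prop :=
  (∀ J ∈ l, r.IsRadicalIdeal J ∧ J ≠ Set.univ) ∧ l.Pairwise (· ⊆ ·) ∧ I = r.product l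

/-- `H` is an `r`-Prüfer monoid. -/
def IsPruefer : Prop :=
  ∀ I : Set H, r.IsIdeal I → r.IsRegularSet I → r.IsFinGen I → r.IsInvertible I

section closure

theorem subset_cl (X : Set H) : X ⊆ r.cl X := fun x hx =>
  r.mul_univ_union_subset_cl X (Or.inl ⟨x, hx, 1, trivial, mul_one x⟩)

theorem cl_mono {X Y : Set H} (h : X ⊆ Y) : r.cl X ⊆ r.cl Y :=
  r.cl_subset_cl_of_subset X Y (h.trans (r.subset_cl Y))

theorem isIdeal_cl (X : Set H) : r.IsIdeal (r.cl X) :=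
  (r.cl_subset_cl_of_subset _ _ subset_rfl).antisymm (r.subset_cl _)

theorem isIdeal_univ : r.IsIdeal (Set.univ : Set H) :=
  (Set.subset_univ _).antisymm (r.subset_cl _)

theorem mul_cl_subset (X Y : Set H) : X * r.cl Y ⊆ r.cl (X * Y) := by
  rintro _ ⟨x, hx, y, hy, rfl⟩
  have h1 : x • Y ⊆ X * Y := by
    rintro _ ⟨z, hz, rfl⟩
    exact ⟨x, hx, z, hz, rfl⟩
  exact r.cl_mono h1 (r.smul_cl_subset_cl_smul x Y ⟨y, hy, rfl⟩)

theorem cl_mul_cl (X Y : Set H) : r.cl (X * r.cl Y) = r.cl (X * Y) :=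
  (r.cl_subset_cl_of_subset _ _ (r.mul_cl_subset X Y)).antisymm
    (r.cl_mono (Set.mul_subset_mul_left (r.subset_cl Y)))

theorem mul_univ_of_isIdeal {I : Set H} (hI : r.IsIdeal I) : I * Set.univ = I := by
  refine Set.Subset.antisymm ?_ fun x hx => ⟨x, hx, 1, trivial, mul_one x⟩
  have h := r.mul_univ_union_subset_cl I
  rw [hI] at h
  exact Set.subset_union_left.trans h

theorem IsRegularElement.mul {x y : H} (hx : r.IsRegularElement x) (hy : r.IsRegularElement y) :
    r.IsRegularElement (x * y) := by
  refine ⟨fun a b h => hy.1 _ _ (hx.1 _ _ (by simpa only [mul_assoc] using h)), fun A => ?_⟩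
  rw [mul_smul, hx.2, hy.2, mul_smul]

theorem cl_empty_mul (I : Set H) : r.cl (I * r.cl ∅) = r.cl ∅ := by
  rw [cl_mul_cl, Set.mul_empty]

end closure

/-- The set `𝓘_r(H)_reg` of the regular `r`-ideals together with the bottom element `∅_r`,
ordered by inclusion. -/
def RegLattice : Type _ := {I : Set H // (r.IsIdeal I ∧ r.IsRegularSet I) ∨ I = r.cl ∅}

namespace RegLattice

variable {r}

theorem isIdeal (I : r.RegLattice) : r.IsIdeal I.1 := by
  rcases I.2 with h | h
  · exact h.1
  · rw [h]; exact r.isIdeal_cl ∅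

instance : PartialOrder r.RegLattice :=
  inferInstanceAs (PartialOrder {I : Set H // (r.IsIdeal I ∧ r.IsRegularSet I) ∨ I = r.cl ∅})

/-- The join of a family is its `r`-union. -/
instance : SupSet r.RegLattice where
  sSup S := ⟨r.cl (⋃ I ∈ S, I.1), by
    by_cases h : ∃ I ∈ S, r.IsRegularSet I.1
    · obtain ⟨I, hI, x, hx, hreg⟩ := h
      exact Or.inl ⟨r.isIdeal_cl _, x, r.subset_cl _ (Set.mem_biUnion hI hx), hreg⟩
    · refine Or.inr (Set.Subset.antisymm ?_ (r.cl_mono (Set.empty_subset _)))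
      refine r.cl_subset_cl_of_subset _ _ (Set.iUnion₂_subset fun I hI => ?_)
      rcases I.2 with h1 | h1
      · exact absurd ⟨I, hI, h1.2⟩ h
      · exact h1.subset⟩

instance : CompleteLattice r.RegLattice :=
  completeLatticeOfSup _ fun S => by
    constructor
    · intro I hI
      exact (Set.subset_biUnion_of_mem (u := fun I : r.RegLattice => I.1) hI).trans
        (r.subset_cl _)
    · intro J hJ
      change r.cl _ ⊆ J.1
      rw [← J.isIdeal]
      refine r.cl_subset_cl_of_subset _ _ (Set.iUnion₂_subset fun I hI => ?_)
      rw [J.isIdeal]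
      exact hJ hI

/-- `r`-multiplication `(I, J) ↦ (IJ)_r`. -/
instance : Mul r.RegLattice where
  mul I J := ⟨r.cl (I.1 * J.1), by
    rcases I.2 with hI | hI
    · rcases J.2 with hJ | hJ
      · obtain ⟨x, hx, hx'⟩ := hI.2
        obtain ⟨y, hy, hy'⟩ := hJ.2
        exact Or.inl ⟨r.isIdeal_cl _, x * y, r.subset_cl _ ⟨x, hx, y, hy, rfl⟩, hx'.mul r hy'⟩
      · exact Or.inr (by rw [hJ, r.cl_empty_mul])
    · exact Or.inr (by rw [hI, mul_comm, r.cl_empty_mul])⟩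

instance : One r.RegLattice where
  one := ⟨Set.univ, Or.inl ⟨r.isIdeal_univ, 1, trivial,
    fun a b h => by simpa using h, fun A => by simp⟩⟩

theorem coe_mul (I J : r.RegLattice) : (I * J).1 = r.cl (I.1 * J.1) := rfl

theorem coe_one : (1 : r.RegLattice).1 = Set.univ := rfl

/-- `r`-multiplication makes `𝓘_r(H)_reg` a commutative monoid with identity `H`. -/
instance : CommMonoid r.RegLattice where
  mul_comm I J := Subtype.ext (by rw [coe_mul, coe_mul, mul_comm])
  mul_assoc I J K := Subtype.ext (by
    simp only [coe_mul]
    rw [r.cl_mul_cl, mul_comm (r.cl _), r.cl_mul_cl, mul_comm K.1, mul_assoc])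
  mul_one I := Subtype.ext (by
    rw [coe_mul, coe_one, r.mul_univ_of_isIdeal I.isIdeal]
    exact I.isIdeal)
  one_mul I := Subtype.ext (by
    rw [coe_mul, coe_one, mul_comm, r.mul_univ_of_isIdeal I.isIdeal]
    exact I.isIdeal)

end RegLattice

/-- The set `r`-`max(H)_reg` of the regular `r`-maximal `r`-ideals. -/
def RegMax : Type _ := {M : Set H // r.IsMaximalIdeal M ∧ r.IsRegularSet M}

/-- The inverse topology on `r`-`max(H)_reg`: the sets `V(x) = {M | x ⊆ M}`, where `x` is a
compact element of the lattice `𝓘_r(H)_reg`, form a basis of open sets. -/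
instance : TopologicalSpace r.RegMax :=
  TopologicalSpace.generateFrom
    {V | ∃ x : r.RegLattice, IsCompactElement x ∧ V = {M : r.RegMax | x.1 ⊆ M.1}}

end WeakIdealSystem

/-- The set `U(X)` of compactly supported upper semicontinuous functions `X → ℕ`. -/
def USCFun (X : Type*) [TopologicalSpace X] : Type _ :=
  {f : X → ℕ // UpperSemicontinuous f ∧ HasCompactSupport f}

namespace USCFun

variable {X : Type*} [TopologicalSpace X]

/-- The order on `U(X)` is dual to the pointwise one: `f ≤ g` iff `f x ≥ g x` for all `x`. -/
instance : PartialOrder (USCFun X) where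
  le f g := ∀ x, g.1 x ≤ f.1 x
  le_refl _ _ := le_rfl
  le_trans _ _ _ h1 h2 x := (h2 x).trans (h1 x)
  le_antisymm _ _ h1 h2 := Subtype.ext (funext fun x => (h2 x).antisymm (h1 x))

instance : Zero (USCFun X) where
  zero := ⟨0, upperSemicontinuous_const, HasCompactSupport.zero⟩

/-- The operation on `U(X)` is pointwise addition. -/
instance : Add (USCFun X) where
  add f g := ⟨f.1 + g.1, f.2.1.add g.2.1, f.2.2.add g.2.2⟩

instance : AddCommMonoid (USCFun X) where
  add_assoc f g h := Subtype.ext (add_assoc f.1 g.1 h.1)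
  zero_add f := Subtype.ext (zero_add f.1)
  add_zero f := Subtype.ext (add_zero f.1)
  add_comm f g := Subtype.ext (add_comm f.1 g.1)
  nsmul := nsmulRec

end USCFun

/-- `U_b(X)`: the partially ordered monoid `U(X)` with a bottom element `b = ⊥` appended, where
`b + f = f + b = b` for all `f`. -/
abbrev UbLattice (X : Type*) [TopologicalSpace X] : Type _ := WithBot (USCFun X)

/-! Everything passes through condition 3, called `PrimesGood` below. It makes `H` look like a
discrete valuation monoid at each regular maximal `M`. If `J ≤ M` is invertible and radical, then
`M` is minimal over `J`, so `M` and `J` agree locally at `M` (`Rad.le_loc`). Hence regular ideals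
are locally powers of `J`, and the exponent `ord` is additive (`ord_mul`) and detects inclusion
globally (`le_iff_ord`). As a function of `M` the order is upper semicontinuous with compact
support. Every such function occurs: an indicator of a closed compact set is the order of the
intersection of its points (`interMax_le_iff`), and the rest are finite sums of indicators. This
gives the isomorphism in 6; comparing orders also yields 7 (`FG.inv`, `FG.rad`), from which 5 is
immediate.

An isomorphism as in 6 is abstract and need not be `ord`, but splitting `f = min f 1 + (f - 1)`
repeatedly still produces a chain of radical ideals (`IsUSCValuation.exists_chain`). The chain is
unique because its first member is determined by the product and regular ideals cancel. This is 4,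
which contains 1.

It remains to return to `PrimesGood`. From 5, a strict inclusion of a regular prime in a larger
prime is refuted by factoring one invertible radical ideal (`primesGood_of_inv_rad`). From 1, the
argument localizes at a prime minimal over `P + C` and separates the locally idempotent case from
the other (`primesGood_of_prod_rad`). Modularity is used only there, through the Nakayama lemma
`Inv.exists_mul_le`. -/

namespace WeakIdealSystem

/-! ### The semiring of `r`-ideals -/

/-- The type of all `r`-ideals. -/
def RIdeal {H : Type*} [CommMonoid H] (r : WeakIdealSystem H) : Type _ := {I : Set H // r.IsIdeal I}

namespace RIdeal

variable {H : Type*} [CommMonoid H] {r : WeakIdealSystem H}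

instance : SetLike r.RIdeal H := ⟨fun I => I.1, Subtype.val_injective⟩

instance : PartialOrder r.RIdeal := .ofSetLike r.RIdeal H

@[ext] theorem ext {I J : r.RIdeal} (h : ∀ x, x ∈ I ↔ x ∈ J) : I = J := SetLike.ext h

theorem cl_coe (I : r.RIdeal) : r.cl (I : Set H) = I := I.2

/-- The `r`-ideal generated by a set. -/
def span (r : WeakIdealSystem H) (X : Set H) : r.RIdeal := ⟨r.cl X, r.isIdeal_cl X⟩

theorem coe_span (X : Set H) : (span r X : Set H) = r.cl X := rfl

theorem subset_span (X : Set H) : X ⊆ span r X := r.subset_cl X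

theorem span_le {X : Set H} {I : r.RIdeal} : span r X ≤ I ↔ X ⊆ I := by
  refine ⟨fun h => (subset_span X).trans h, fun h => ?_⟩
  have h1 := r.cl_mono h
  rw [cl_coe] at h1
  exact h1

theorem span_coe (I : r.RIdeal) : span r (I : Set H) = I := SetLike.coe_injective I.cl_coe

theorem mul_mem_right {I : r.RIdeal} {x : H} (y : H) (hx : x ∈ I) : x * y ∈ I := by
  have h := r.mul_univ_of_isIdeal I.2
  change x * y ∈ I.1
  rw [← h]
  exact ⟨x, hx, y, trivial, rfl⟩

theorem mul_mem_left {I : r.RIdeal} {x : H} (y : H) (hx : x ∈ I) : y * x ∈ I :=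
  mul_comm x y ▸ mul_mem_right y hx

theorem span_mul_span (X Y : Set H) :
    span r ((span r X : Set H) * (span r Y : Set H)) = span r (X * Y) := by
  apply SetLike.coe_injective
  change r.cl (r.cl X * r.cl Y) = r.cl (X * Y)
  rw [r.cl_mul_cl, mul_comm, r.cl_mul_cl, mul_comm]

instance : Mul r.RIdeal := ⟨fun I J => span r ((I : Set H) * (J : Set H))⟩
instance : Add r.RIdeal := ⟨fun I J => span r ((I : Set H) ∪ (J : Set H))⟩
instance : One r.RIdeal := ⟨⟨Set.univ, r.isIdeal_univ⟩⟩
instance : Zero r.RIdeal := ⟨span r ∅⟩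

theorem mul_def (I J : r.RIdeal) : I * J = span r ((I : Set H) * (J : Set H)) := rfl
theorem coe_mul (I J : r.RIdeal) : ((I * J : r.RIdeal) : Set H) = r.cl
    ((I : Set H) * (J : Set H)) := rfl
theorem add_def (I J : r.RIdeal) : I + J = span r ((I : Set H) ∪ (J : Set H)) := rfl
theorem mem_one (x : H) : x ∈ (1 : r.RIdeal) := Set.mem_univ x

theorem span_mul (X Y : Set H) : span r X * span r Y = span r (X * Y) := span_mul_span X Y

theorem mul_le {I J K : r.RIdeal} : I * J ≤ K ↔ ∀ x ∈ I, ∀ y ∈ J, x * y ∈ K := by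
  rw [mul_def, span_le, Set.mul_subset_iff]; rfl

theorem mul_mem_mul {I J : r.RIdeal} {x y : H} (hx : x ∈ I) (hy : y ∈ J) : x * y ∈ I * J :=
  mul_le.1 le_rfl x hx y hy

theorem add_le {I J K : r.RIdeal} : I + J ≤ K ↔ I ≤ K ∧ J ≤ K := by
  rw [add_def, span_le, Set.union_subset_iff]; rfl

theorem le_add_left' (I J : r.RIdeal) : I ≤ I + J := (add_le.1 le_rfl).1
theorem le_add_right' (I J : r.RIdeal) : J ≤ I + J := (add_le.1 le_rfl).2

/-- The set of all `a` with `a C ⊆ A`. -/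
def colon (A C : r.RIdeal) : r.RIdeal := ⟨{a | ∀ c ∈ C, a * c ∈ A}, by
  refine Set.Subset.antisymm (fun a ha c hc => ?_) (r.subset_cl _)
  have h1 := r.smul_cl_subset_cl_smul c _ ⟨a, ha, rfl⟩
  have h2 : span r (c • {a | ∀ c ∈ C, a * c ∈ A}) ≤ A := by
    rw [span_le]
    rintro _ ⟨b, hb, rfl⟩
    change c * b ∈ A
    rw [mul_comm]
    exact hb c hc
  exact mul_comm c a ▸ h2 h1⟩

theorem mem_colon {A C : r.RIdeal} {a : H} : a ∈ colon A C ↔ ∀ c ∈ C, a * c ∈ A := Iff.rfl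

/-- Multiplication by a fixed ideal has a right adjoint. Distributivity over sums below is a formal
consequence. -/
theorem le_colon {A C K : r.RIdeal} : K ≤ colon A C ↔ K * C ≤ A := by
  rw [mul_le]; rfl

theorem colon_mul_le (A C : r.RIdeal) : colon A C * C ≤ A := le_colon.1 le_rfl

/-- Sum is join and `0` is the closure of the empty set; the instance lets `ring` rearrange products
of ideals. -/
instance : IdemCommSemiring r.RIdeal where
  add_assoc I J K := le_antisymm
    (add_le.2 ⟨add_le.2 ⟨le_add_left' _ _, (le_add_left' _ _).trans (le_add_right' _ _)⟩,
      (le_add_right' _ _).trans (le_add_right' _ _)⟩)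
    (add_le.2 ⟨(le_add_left' _ _).trans (le_add_left' _ _),
      add_le.2 ⟨(le_add_right' _ _).trans (le_add_left' _ _), le_add_right' _ _⟩⟩)
  zero_add I := le_antisymm (add_le.2 ⟨span_le.2 (Set.empty_subset _), le_rfl⟩) (le_add_right' _ _)
  add_zero I := le_antisymm (add_le.2 ⟨le_rfl, span_le.2 (Set.empty_subset _)⟩) (le_add_left' _ _)
  add_comm I J := by rw [add_def, Set.union_comm]; rfl
  nsmul := nsmulRec
  left_distrib I J K := by
    refine le_antisymm ?_ (add_le.2 ⟨mul_le.2 fun x hx y hy => mul_mem_mul hx (le_add_left' _ _ hy),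
      mul_le.2 fun x hx y hy => mul_mem_mul hx (le_add_right' _ _ hy)⟩)
    have h : J + K ≤ colon (I * J + I * K) I := add_le.2
      ⟨le_colon.2 (mul_le.2 fun x hx y hy => le_add_left' _ _ (mul_comm x y ▸ mul_mem_mul hy hx)),
       le_colon.2 (mul_le.2 fun x hx y hy => le_add_right' _ _ (mul_comm x y ▸ mul_mem_mul hy hx))⟩
    exact mul_le.2 fun x hx y hy => mul_comm y x ▸ h hy x hx
  right_distrib J K I := by
    refine le_antisymm ?_ (add_le.2 ⟨mul_le.2 fun x hx y hy => mul_mem_mul (le_add_left' _ _ hx) hy,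
      mul_le.2 fun x hx y hy => mul_mem_mul (le_add_right' _ _ hx) hy⟩)
    exact le_colon.1 (add_le.2
      ⟨le_colon.2 (le_add_left' _ _), le_colon.2 (le_add_right' _ _)⟩)
  zero_mul I := by
    apply SetLike.coe_injective
    change r.cl (r.cl ∅ * I) = _
    rw [mul_comm, r.cl_empty_mul]; rfl
  mul_zero I := by
    apply SetLike.coe_injective
    change r.cl (I * r.cl ∅) = _
    rw [r.cl_empty_mul]; rfl
  mul_assoc I J K := by
    conv_lhs => rw [← span_coe K, mul_def I J, span_mul]
    conv_rhs => rw [← span_coe I, mul_def J K, span_mul, ← mul_assoc]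
  one_mul I := le_antisymm (mul_le.2 fun x _ y hy => mul_mem_left x hy)
    fun x hx => by simpa using mul_mem_mul (mem_one (r := r) 1) hx
  mul_one I := le_antisymm (mul_le.2 fun x hx y _ => mul_mem_right y hx)
    fun x hx => by simpa using mul_mem_mul hx (mem_one (r := r) 1)
  npow := npowRec
  mul_comm I J := by rw [mul_def, mul_comm]; rfl
  sup := (· + ·)
  le_sup_left := le_add_left'
  le_sup_right := le_add_right'
  sup_le _ _ _ h1 h2 := add_le.2 ⟨h1, h2⟩
  bot := 0
  bot_le I := span_le.2 (Set.empty_subset _)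

theorem le_one (I : r.RIdeal) : I ≤ 1 := fun x _ => mem_one x

theorem one_le_iff {I : r.RIdeal} : 1 ≤ I ↔ (1 : H) ∈ I :=
  ⟨fun h => h (mem_one 1), fun h x _ => by simpa using mul_mem_left x h⟩

theorem mul_le_left (I J : r.RIdeal) : I * J ≤ I := mul_le.2 fun _ hx y _ => mul_mem_right y hx

theorem mul_le_right (I J : r.RIdeal) : I * J ≤ J := mul_le.2 fun x _ _ hy => mul_mem_left x hy

theorem mul_mono {I J K L : r.RIdeal} (h1 : I ≤ J) (h2 : K ≤ L) : I * K ≤ J * L :=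
  mul_le.2 fun _ hx _ hy => mul_mem_mul (h1 hx) (h2 hy)

theorem pow_mem_pow {I : r.RIdeal} {x : H} (hx : x ∈ I) (n : ℕ) : x ^ n ∈ I ^ n := by
  induction n with
  | zero => simpa using mem_one _
  | succ n ih => rw [pow_succ, pow_succ]; exact mul_mem_mul ih hx

theorem pow_mono {I J : r.RIdeal} (h : I ≤ J) (n : ℕ) : I ^ n ≤ J ^ n := by
  induction n with
  | zero => simp
  | succ n ih => rw [pow_succ, pow_succ]; exact mul_mono ih h

theorem pow_le_pow_right {I : r.RIdeal} {m n : ℕ} (h : m ≤ n) : I ^ n ≤ I ^ m := by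
  obtain ⟨k, rfl⟩ := Nat.exists_eq_add_of_le h
  rw [pow_add]; exact mul_le_left _ _

/-- The principal `r`-ideal generated by `x`. -/
def prin (r : WeakIdealSystem H) (x : H) : r.RIdeal := span r {x}

theorem prin_le {x : H} {I : r.RIdeal} : prin r x ≤ I ↔ x ∈ I := by
  rw [prin, span_le]; simp

theorem mem_prin (x : H) : x ∈ prin r x := prin_le.1 le_rfl

theorem prin_mul (x y : H) : prin r (x * y) = prin r x * prin r y := by
  rw [prin, prin, prin, span_mul, Set.singleton_mul_singleton]

theorem prin_one : prin r 1 = 1 := le_antisymm (le_one _) (one_le_iff.2 (mem_prin 1))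

theorem prin_pow (x : H) (n : ℕ) : prin r (x ^ n) = prin r x ^ n := by
  induction n with
  | zero => simp [prin_one]
  | succ n ih => rw [pow_succ, pow_succ, prin_mul, ih]

theorem prin_mul_le {x : H} {I J : r.RIdeal} : prin r x * I ≤ J ↔ ∀ y ∈ I, x * y ∈ J := by
  refine ⟨fun h y hy => h (mul_mem_mul (mem_prin x) hy), fun h => ?_⟩
  rw [← le_colon, prin_le]
  exact h

theorem prin_mul_span_le {x : H} {X : Set H} {J : r.RIdeal} :
    prin r x * span r X ≤ J ↔ ∀ y ∈ X, x * y ∈ J := by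
  rw [prin, span_mul, span_le, Set.singleton_mul, Set.image_subset_iff]; rfl

theorem not_le_iff {I J : r.RIdeal} : ¬ I ≤ J ↔ ∃ x ∈ I, x ∉ J := SetLike.not_le_iff_exists

/-- `r`-finitely generated `r`-ideals. -/
def FG (I : r.RIdeal) : Prop := ∃ E : Set H, E.Finite ∧ I = span r E

theorem fg_iff {I : r.RIdeal} : I.FG ↔ r.IsFinGen (I : Set H) := by
  constructor
  · rintro ⟨E, hE, rfl⟩
    exact ⟨E, hE, subset_span E, rfl⟩
  · rintro ⟨E, hE, -, h⟩
    exact ⟨E, hE, SetLike.coe_injective h⟩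

theorem FG.mul {I J : r.RIdeal} (hI : I.FG) (hJ : J.FG) : (I * J).FG := by
  obtain ⟨E, hE, rfl⟩ := hI
  obtain ⟨F, hF, rfl⟩ := hJ
  exact ⟨E * F, hE.mul hF, span_mul E F⟩

theorem FG.add {I J : r.RIdeal} (hI : I.FG) (hJ : J.FG) : (I + J).FG := by
  obtain ⟨E, hE, rfl⟩ := hI
  obtain ⟨F, hF, rfl⟩ := hJ
  refine ⟨E ∪ F, hE.union hF, le_antisymm (add_le.2 ⟨?_, ?_⟩) (span_le.2 (Set.union_subset ?_ ?_))⟩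
  · exact span_le.2 (Set.subset_union_left.trans (subset_span _))
  · exact span_le.2 (Set.subset_union_right.trans (subset_span _))
  · exact (subset_span E).trans (le_add_left' (span r E) (span r F))
  · exact (subset_span F).trans (le_add_right' (span r E) (span r F))

theorem fg_prin (x : H) : (prin r x).FG := ⟨{x}, Set.finite_singleton x, rfl⟩

theorem fg_one : (1 : r.RIdeal).FG := prin_one (r := r) ▸ fg_prin 1

/-- Regular `r`-ideals. -/
def Reg (I : r.RIdeal) : Prop := r.IsRegularSet (I : Set H)

theorem Reg.mono {I J : r.RIdeal} (hI : I.Reg) (h : I ≤ J) : J.Reg := by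
  obtain ⟨x, hx, hr⟩ := hI
  exact ⟨x, h hx, hr⟩

theorem Reg.mul {I J : r.RIdeal} (hI : I.Reg) (hJ : J.Reg) : (I * J).Reg := by
  obtain ⟨x, hx, hr⟩ := hI
  obtain ⟨y, hy, hs⟩ := hJ
  exact ⟨x * y, mul_mem_mul hx hy, hr.mul r hs⟩

theorem isRegularElement_one : r.IsRegularElement 1 :=
  ⟨fun a b h => by simpa using h, fun A => by simp⟩

theorem reg_one : (1 : r.RIdeal).Reg := ⟨1, mem_one 1, isRegularElement_one⟩

theorem Reg.pow {I : r.RIdeal} (hI : I.Reg) (n : ℕ) : (I ^ n).Reg := by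
  induction n with
  | zero => simpa using reg_one
  | succ n ih => rw [pow_succ]; exact ih.mul hI

theorem Reg.exists_fg {I : r.RIdeal} {E : Set H} (hE : E.Finite) (h : E ⊆ I) (hI : I.Reg) :
    ∃ D : r.RIdeal, D.FG ∧ D.Reg ∧ E ⊆ D ∧ D ≤ I := by
  obtain ⟨y, hy, hr⟩ := hI
  refine ⟨span r (insert y E), ⟨_, hE.insert y, rfl⟩, ⟨y, subset_span _ (Set.mem_insert _ _), hr⟩,
    (Set.subset_insert _ _).trans (subset_span _), span_le.2 (Set.insert_subset hy h)⟩

theorem mem_span_finite (hfin : r.Finitary) {X : Set H} {x : H} (hx : x ∈ span r X) :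
    ∃ E ⊆ X, E.Finite ∧ x ∈ span r E := by
  have h : x ∈ r.cl X := hx
  rw [hfin X] at h
  simp only [Set.mem_iUnion] at h
  obtain ⟨E, ⟨h1, h2⟩, h3⟩ := h
  exact ⟨E, h1, h2, h3⟩

theorem mem_mul_finite (hfin : r.Finitary) {I J : r.RIdeal} {x : H} (hx : x ∈ I * J) :
    ∃ E F : Set H, E ⊆ I ∧ F ⊆ J ∧ E.Finite ∧ F.Finite ∧ x ∈ span r E * span r F := by
  obtain ⟨G, hG, hGf, hxG⟩ := mem_span_finite hfin hx
  choose! a ha b hb hab using fun g (hg : g ∈ G) => Set.mem_mul.1 (hG hg)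
  refine ⟨a '' G, b '' G, Set.image_subset_iff.2 ha, Set.image_subset_iff.2 hb, hGf.image a,
    hGf.image b, ?_⟩
  rw [span_mul]
  refine r.cl_mono (fun g hg => ?_) hxG
  rw [← hab g hg]
  exact Set.mul_mem_mul (Set.mem_image_of_mem a hg) (Set.mem_image_of_mem b hg)

/-- A directed union of `r`-ideals is an `r`-ideal when `r` is finitary. -/
theorem isIdeal_of_finite (hfin : r.Finitary) {X : Set H}
    (h : ∀ E ⊆ X, E.Finite → ∃ I : r.RIdeal, E ⊆ I ∧ (I : Set H) ⊆ X) : r.IsIdeal X := by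
  refine Set.Subset.antisymm (fun x hx => ?_) (r.subset_cl X)
  obtain ⟨E, h1, h2, h3⟩ := mem_span_finite hfin hx
  obtain ⟨I, h4, h5⟩ := h E h1 h2
  exact h5 (span_le.2 h4 h3)

/-! ### Invertible ideals and cancellation -/

/-- Invertible `r`-ideals. -/
def Inv (I : r.RIdeal) : Prop := ∃ (J : r.RIdeal) (y : H), r.IsRegularElement y ∧ I * J = prin r y

theorem coe_prin_of_regular {y : H} (hy : r.IsRegularElement y) :
    (prin r y : Set H) = y • (Set.univ : Set H) := by
  have h := hy.2 {1}
  have h1 : r.cl {(1 : H)} = Set.univ := congrArg (SetLike.coe) (prin_one (r := r))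
  rw [h1] at h
  rw [← h]
  simp [prin, coe_span]

theorem inv_iff {I : r.RIdeal} : I.Inv ↔ r.IsInvertible (I : Set H) := by
  constructor
  · rintro ⟨J, y, hy, h⟩
    refine ⟨J, y, hy, ?_⟩
    rw [← coe_prin_of_regular hy, ← h]; rfl
  · rintro ⟨J, y, hy, h⟩
    refine ⟨span r J, y, hy, SetLike.coe_injective ?_⟩
    rw [coe_prin_of_regular hy, ← h]
    exact r.cl_mul_cl _ _

/-- Regularity of `y` says that the translate of a closed set is already closed. Cancellation of `y`
on elements thus becomes cancellation on ideals. -/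
theorem prin_mul_coe {y : H} (hy : r.IsRegularElement y) (A : r.RIdeal) :
    ((prin r y * A : r.RIdeal) : Set H) = y • (A : Set H) := by
  conv_lhs => rw [prin, ← span_coe A, span_mul, coe_span, Set.singleton_mul]
  have := hy.2 (A : Set H)
  rw [cl_coe] at this
  exact this

theorem prin_mul_le_cancel {y : H} (hy : r.IsRegularElement y) {A B : r.RIdeal}
    (h : prin r y * A ≤ prin r y * B) : A ≤ B := by
  intro a ha
  have h1 : y * a ∈ ((prin r y * B : r.RIdeal) : Set H) := h (mul_mem_mul (mem_prin y) ha)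
  rw [prin_mul_coe hy] at h1
  obtain ⟨b, hb, hab⟩ := h1
  rwa [← hy.1 b a hab]

theorem Inv.cancel_le {I A B : r.RIdeal} (hI : I.Inv) (h : I * A ≤ I * B) : A ≤ B := by
  obtain ⟨J, y, hy, hJ⟩ := hI
  apply prin_mul_le_cancel hy
  rw [← hJ, mul_comm I J, mul_assoc, mul_assoc]
  exact mul_mono le_rfl h

theorem Inv.cancel {I A B : r.RIdeal} (hI : I.Inv) (h : I * A = I * B) : A = B :=
  le_antisymm (hI.cancel_le h.le) (hI.cancel_le h.ge)

/-- To contain is to divide: with `I * J` generated by `y`, the ideal `A * J` lies in `yH`, so it is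
`y` times a colon ideal, and `y` cancels. -/
theorem Inv.dvd {I A : r.RIdeal} (hI : I.Inv) (h : A ≤ I) : ∃ C, A = I * C := by
  obtain ⟨J, y, hy, hJ⟩ := id hI
  have h1 : A * J ≤ prin r y := hJ ▸ mul_mono h le_rfl
  refine ⟨colon (A * J) (prin r y), ?_⟩
  have key : prin r y * colon (A * J) (prin r y) = A * J := by
    refine le_antisymm (mul_comm _ (prin r y) ▸ colon_mul_le _ _) fun x hx => ?_
    have hx1 : x ∈ (prin r y : Set H) := h1 hx
    rw [coe_prin_of_regular hy] at hx1
    obtain ⟨c, -, rfl⟩ := hx1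
    refine mul_mem_mul (mem_prin y) ?_
    rw [← prin_le, le_colon, mul_comm, ← prin_mul, prin_le]
    exact hx
  have hyi : (prin r y).Inv := ⟨1, y, hy, mul_one _⟩
  apply hyi.cancel
  calc prin r y * A = I * J * A := by rw [hJ]
    _ = I * (A * J) := by ring
    _ = I * (prin r y * colon (A * J) (prin r y)) := by rw [key]
    _ = prin r y * (I * colon (A * J) (prin r y)) := mul_left_comm _ _ _

theorem inv_prin {y : H} (hy : r.IsRegularElement y) : (prin r y).Inv := ⟨1, y, hy, mul_one _⟩

theorem inv_one : (1 : r.RIdeal).Inv := prin_one (r := r) ▸ inv_prin isRegularElement_one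

theorem Inv.reg {I : r.RIdeal} (hI : I.Inv) : I.Reg := by
  obtain ⟨J, y, hy, hJ⟩ := hI
  exact ⟨y, mul_le_left I J (hJ ▸ mem_prin y), hy⟩

theorem Inv.mul {I J : r.RIdeal} (hI : I.Inv) (hJ : J.Inv) : (I * J).Inv := by
  obtain ⟨A, y, hy, hA⟩ := hI
  obtain ⟨B, z, hz, hB⟩ := hJ
  exact ⟨A * B, y * z, hy.mul r hz, by rw [prin_mul, ← hA, ← hB]; ring⟩

theorem Inv.pow {I : r.RIdeal} (hI : I.Inv) (n : ℕ) : (I ^ n).Inv := by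
  induction n with
  | zero => simpa using inv_one
  | succ n ih => rw [pow_succ]; exact ih.mul hI

theorem Inv.of_mul_left {I J : r.RIdeal} (h : (I * J).Inv) : I.Inv := by
  obtain ⟨A, y, hy, hA⟩ := h
  exact ⟨J * A, y, hy, by rw [← hA]; ring⟩

theorem Inv.of_mul_right {I J : r.RIdeal} (h : (I * J).Inv) : J.Inv :=
  Inv.of_mul_left (mul_comm I J ▸ h)

/-- Membership of `y` in `I * J` involves only a finite `E ⊆ I`. Then `y I ≤ E J I = y E`, and `y`
cancels. -/
theorem Inv.fg (hfin : r.Finitary) {I : r.RIdeal} (hI : I.Inv) : I.FG := by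
  obtain ⟨J, y, hy, hJ⟩ := hI
  obtain ⟨E, F, hE, hF, hEf, hFf, h⟩ := mem_mul_finite hfin (hJ ▸ mem_prin y : y ∈ I * J)
  refine ⟨E, hEf, le_antisymm ?_ (span_le.2 hE)⟩
  apply prin_mul_le_cancel hy
  calc prin r y * I ≤ span r E * span r F * I := mul_mono (prin_le.2 h) le_rfl
    _ ≤ span r E * J * I := mul_mono (mul_mono le_rfl (span_le.2 hF)) le_rfl
    _ = I * J * span r E := by ring
    _ = prin r y * span r E := by rw [hJ]

end RIdeal

end WeakIdealSystem

/-! ### Prime, maximal and radical ideals -/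

namespace WeakIdealSystem

namespace RIdeal

variable {H : Type*} [CommMonoid H] {r : WeakIdealSystem H}

/-- Prime `r`-ideals. -/
structure Prim (P : r.RIdeal) : Prop where
  one_notMem : (1 : H) ∉ P
  mem_or_mem : ∀ x y : H, x * y ∈ P → x ∈ P ∨ y ∈ P

theorem ne_one_iff {I : r.RIdeal} : (I : Set H) ≠ Set.univ ↔ (1 : H) ∉ I := by
  rw [← one_le_iff, not_iff_not]
  refine ⟨fun h x _ => ?_, fun h => Set.eq_univ_of_forall fun x => h (mem_one x)⟩
  change x ∈ (I : Set H)
  rw [h]; trivial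

theorem prim_iff {P : r.RIdeal} : P.Prim ↔ r.IsPrimeIdeal (P : Set H) :=
  ⟨fun h => ⟨P.2, ne_one_iff.2 h.1, h.2⟩, fun h => ⟨ne_one_iff.1 h.2.1, h.2.2⟩⟩

theorem Prim.mul_notMem {P : r.RIdeal} (hP : P.Prim) {s t : H} (hs : s ∉ P) (ht : t ∉ P) :
    s * t ∉ P := fun h => (hP.2 s t h).elim hs ht

theorem Prim.le_or_le {P I J : r.RIdeal} (hP : P.Prim) (h : I * J ≤ P) : I ≤ P ∨ J ≤ P := by
  by_contra! hc
  obtain ⟨x, hx, hxP⟩ := not_le_iff.1 hc.1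
  obtain ⟨y, hy, hyP⟩ := not_le_iff.1 hc.2
  exact hP.mul_notMem hxP hyP (h (mul_mem_mul hx hy))

theorem Prim.mem_of_pow {P : r.RIdeal} (hP : P.Prim) {n : ℕ} {x : H} (h : x ^ n ∈ P) : x ∈ P := by
  induction n with
  | zero => rw [pow_zero] at h; exact absurd h hP.1
  | succ n ih => rw [pow_succ] at h; exact (hP.2 _ _ h).elim ih id

theorem Prim.le_of_pow {P I : r.RIdeal} (hP : P.Prim) {n : ℕ} (h : I ^ n ≤ P) : I ≤ P :=
  fun _ hx => hP.mem_of_pow (h (pow_mem_pow hx n))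

/-- Maximal `r`-ideals. -/
def Maxi (M : r.RIdeal) : Prop := r.IsMaximalIdeal (M : Set H)

theorem maxi_iff {M : r.RIdeal} :
    M.Maxi ↔ (1 : H) ∉ M ∧ ∀ I : r.RIdeal, M ≤ I → ¬ I ≤ M → (1 : H) ∈ I := by
  constructor
  · rintro ⟨⟨-, h1⟩, h2⟩
    refine ⟨ne_one_iff.1 h1, fun I hI hIM => ?_⟩
    by_contra h
    exact hIM (h2 ⟨I.2, ne_one_iff.2 h⟩ hI)
  · rintro ⟨h1, h2⟩
    refine ⟨⟨M.2, ne_one_iff.2 h1⟩, fun I hI hMI => ?_⟩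
    by_contra h
    have h3 : ((⟨I, hI.1⟩ : r.RIdeal) : Set H) ≠ Set.univ := hI.2
    exact ne_one_iff.1 h3 (h2 ⟨I, hI.1⟩ hMI h)

theorem Maxi.one_mem_add {M I : r.RIdeal} (hM : M.Maxi) (h : ¬ I ≤ M) : (1 : H) ∈ I + M :=
  (maxi_iff.1 hM).2 _ (le_add_right' I M) fun hc => h ((le_add_left' I M).trans hc)

/-- An `r`-ideal maximal among those containing no member of a multiplicative family of finitely
generated `r`-ideals exists above any such `r`-ideal and is prime. -/
theorem exists_prim_of_submonoid (hfin : r.Finitary) (T : Submonoid r.RIdeal)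
    (hT : ∀ A ∈ T, A.FG) {I : r.RIdeal} (hI : ∀ A ∈ T, ¬ A ≤ I) :
    ∃ P : r.RIdeal, P.Prim ∧ I ≤ P ∧ (∀ A ∈ T, ¬ A ≤ P) ∧
      ∀ Q : r.RIdeal, P ≤ Q → ¬ Q ≤ P → ∃ A ∈ T, A ≤ Q := by
  obtain ⟨P, hIP, hP⟩ := zorn_le_nonempty₀ {P : r.RIdeal | ∀ A ∈ T, ¬ A ≤ P} (by
    intro c hc hchain y hy
    have hex : ∀ E ⊆ ⋃ J ∈ c, (J : Set H), E.Finite → ∃ J ∈ c, E ⊆ J := by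
      intro E hE hEf
      induction E, hEf using Set.Finite.induction_on with
      | empty => exact ⟨y, hy, Set.empty_subset _⟩
      | @insert a s _ _ ih =>
        obtain ⟨J, hJ, hsJ⟩ := ih ((Set.subset_insert _ _).trans hE)
        obtain ⟨K, hK, haK⟩ := Set.mem_iUnion₂.1 (hE (Set.mem_insert a s))
        rcases hchain.total hJ hK with h | h
        · exact ⟨K, hK, Set.insert_subset haK (hsJ.trans h)⟩
        · exact ⟨J, hJ, Set.insert_subset (h haK) hsJ⟩
    refine ⟨⟨⋃ J ∈ c, (J : Set H), isIdeal_of_finite hfin fun E hE hEf => ?_⟩, ?_, ?_⟩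
    · obtain ⟨J, hJ, h⟩ := hex E hE hEf
      exact ⟨J, h, Set.subset_biUnion_of_mem (u := fun J : r.RIdeal => (J : Set H)) hJ⟩
    · intro A hA hle
      obtain ⟨E, hEf, rfl⟩ := hT A hA
      obtain ⟨J, hJ, h⟩ := hex E (span_le.1 hle) hEf
      exact hc hJ _ hA (span_le.2 h)
    · exact fun J hJ => Set.subset_biUnion_of_mem (u := fun J : r.RIdeal => (J : Set H)) hJ) I hI
  have hmax : ∀ Q : r.RIdeal, P ≤ Q → ¬ Q ≤ P → ∃ A ∈ T, A ≤ Q := by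
    intro Q hPQ hQP
    by_contra! hc
    exact hQP (hP.2 hc hPQ)
  refine ⟨P, ⟨fun h => hP.1 1 T.one_mem (one_le_iff.2 h), fun x y hxy => ?_⟩, hIP, hP.1, hmax⟩
  by_contra! hc
  -- If `x` and `y` both lie outside `P`, the two enlargements contain members of `T`, whose product
  -- lies in `P + (xy) = P`.
  have aux : ∀ z, z ∉ P → ∃ A ∈ T, A ≤ P + prin r z := fun z hz =>
    hmax _ (le_add_left' _ _) fun h => hz (prin_le.1 ((le_add_right' _ _).trans h))
  obtain ⟨A, hA, hAx⟩ := aux x hc.1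
  obtain ⟨B, hB, hBy⟩ := aux y hc.2
  refine hP.1 _ (T.mul_mem hA hB) ((mul_mono hAx hBy).trans ?_)
  have e : (P + prin r x) * (P + prin r y) = P * (P + prin r y + prin r x) + prin r (x * y) := by
    rw [prin_mul]; ring
  rw [e]
  exact add_le.2 ⟨mul_le_left _ _, prin_le.2 hxy⟩

theorem exists_maxi (hfin : r.Finitary) {I : r.RIdeal} (hI : (1 : H) ∉ I) :
    ∃ M : r.RIdeal, M.Maxi ∧ M.Prim ∧ I ≤ M := by
  obtain ⟨P, hP, hIP, h1, h2⟩ := exists_prim_of_submonoid hfin (⊥ : Submonoid r.RIdeal)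
    (by rintro A hA; rw [Submonoid.mem_bot.1 hA]; exact fg_one) (I := I)
    (by rintro A hA; rw [Submonoid.mem_bot.1 hA, one_le_iff]; exact hI)
  refine ⟨P, maxi_iff.2 ⟨hP.1, fun Q hPQ hQP => ?_⟩, hP, hIP⟩
  obtain ⟨A, hA, hAQ⟩ := h2 Q hPQ hQP
  rw [Submonoid.mem_bot.1 hA] at hAQ
  exact one_le_iff.1 hAQ

theorem Maxi.prim (hfin : r.Finitary) {M : r.RIdeal} (hM : M.Maxi) : M.Prim := by
  obtain ⟨N, hN, hNp, h⟩ := exists_maxi hfin (maxi_iff.1 hM).1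
  have : N ≤ M := by
    by_contra hc
    exact hNp.1 ((maxi_iff.1 hM).2 N h hc)
  rwa [le_antisymm h this]

theorem Maxi.eq_of_le {M I : r.RIdeal} (hM : M.Maxi) (hI : (1 : H) ∉ I) (h : M ≤ I) : M = I :=
  le_antisymm h (by by_contra hc; exact hI ((maxi_iff.1 hM).2 I h hc))

/-- If each prime `r`-ideal above `I` contains a member of a family of finitely generated
`r`-ideals, then `I` contains a finite product of members of the family. -/
theorem exists_prod_le (hfin : r.Finitary) {S : Set r.RIdeal} (hS : ∀ A ∈ S, A.FG) {I : r.RIdeal}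
    (h : ∀ P : r.RIdeal, P.Prim → I ≤ P → ∃ A ∈ S, A ≤ P) : ∃ A ∈ Submonoid.closure S, A ≤ I := by
  by_contra! hc
  obtain ⟨P, hP, hIP, h1, -⟩ := exists_prim_of_submonoid hfin (Submonoid.closure S)
    (fun A hA => Submonoid.closure_induction hS fg_one (fun _ _ _ _ h1 h2 => h1.mul h2) hA) hc
  obtain ⟨A, hA, hAP⟩ := h P hP hIP
  exact h1 A (Submonoid.subset_closure hA) hAP

/-- Above an `r`-ideal disjoint from a multiplicative set there is a prime `r`-ideal disjoint
from it. -/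
theorem exists_prim_disjoint (hfin : r.Finitary) (S : Submonoid H) {I : r.RIdeal}
    (hI : ∀ s ∈ S, s ∉ I) : ∃ P : r.RIdeal, P.Prim ∧ I ≤ P ∧ ∀ s ∈ S, s ∉ P := by
  let f : H →* r.RIdeal := ⟨⟨prin r, prin_one⟩, prin_mul⟩
  obtain ⟨P, hP, hIP, h, -⟩ := exists_prim_of_submonoid hfin (S.map f)
    (by rintro _ ⟨s, -, rfl⟩; exact fg_prin s) (I := I)
    (by rintro _ ⟨s, hs, rfl⟩ h; exact hI s hs (prin_le.1 h))
  exact ⟨P, hP, hIP, fun s hs hsP => h _ ⟨s, hs, rfl⟩ (prin_le.2 hsP)⟩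

/-- Every prime `r`-ideal above `I` contains a prime `r`-ideal minimal above `I`. -/
theorem exists_minimal_prim {I M : r.RIdeal} (hM : M.Prim) (hIM : I ≤ M) :
    ∃ N : r.RIdeal, N.Prim ∧ I ≤ N ∧ N ≤ M ∧ ∀ Q : r.RIdeal, Q.Prim → I ≤ Q → Q ≤ N → N ≤ Q := by
  obtain ⟨N, hNM, hN⟩ := zorn_superset_nonempty {X : Set H | ∃ P : r.RIdeal,
    P.Prim ∧ I ≤ P ∧ (P : Set H) = X} (by
    rintro c hc hchain ⟨Y, hY⟩
    have hid : r.IsIdeal (⋂₀ c) := by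
      refine Set.Subset.antisymm (Set.subset_sInter fun X hX => ?_) (r.subset_cl _)
      obtain ⟨P, -, -, rfl⟩ := hc hX
      conv_rhs => rw [← cl_coe P]
      exact r.cl_mono (Set.sInter_subset_of_mem hX)
    refine ⟨⋂₀ c, ⟨⟨_, hid⟩, ⟨fun h => ?_, fun x y hxy => ?_⟩, ?_, rfl⟩,
      fun s hs => Set.sInter_subset_of_mem hs⟩
    · obtain ⟨P, hP, -, rfl⟩ := hc hY
      exact hP.1 (h _ hY)
    · by_contra! hcon
      have hx : ¬ ∀ t ∈ c, x ∈ t := hcon.1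
      have hy : ¬ ∀ t ∈ c, y ∈ t := hcon.2
      push Not at hx hy
      obtain ⟨A, hA, hxA⟩ := hx
      obtain ⟨B, hB, hyB⟩ := hy
      rcases hchain.total hA hB with h | h
      · obtain ⟨P, hP, -, rfl⟩ := hc hA
        exact (hP.2 x y (hxy _ hA)).elim hxA fun h1 => hyB (h h1)
      · obtain ⟨P, hP, -, rfl⟩ := hc hB
        exact (hP.2 x y (hxy _ hB)).elim (fun h1 => hxA (h h1)) hyB
    · intro x hx X hX
      obtain ⟨P, -, hIP, rfl⟩ := hc hX
      exact hIP hx) (M : Set H) ⟨M, hM, hIM, rfl⟩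
  obtain ⟨⟨N, hNp, hIN, rfl⟩, hmin⟩ := hN
  exact ⟨N, hNp, hIN, hNM, fun Q hQ hIQ hQN => hmin ⟨Q, hQ, hIQ, rfl⟩ hQN⟩

/-- Radical `r`-ideals. -/
def Rad (I : r.RIdeal) : Prop := ∀ (n : ℕ) (x : H), 0 < n → x ^ n ∈ I → x ∈ I

theorem rad_iff {I : r.RIdeal} : I.Rad ↔ r.IsRadicalIdeal (I : Set H) :=
    ⟨fun h => ⟨I.2, h⟩, fun h => h.2⟩

theorem Rad.le_of_pow {I K : r.RIdeal} (hI : I.Rad) {n : ℕ} (hn : 0 < n) (h : K ^ n ≤ I) : K ≤ I :=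
  fun x hx => hI n x hn (h (pow_mem_pow hx n))

theorem Prim.rad {P : r.RIdeal} (hP : P.Prim) : P.Rad := fun _ _ _ h => hP.mem_of_pow h

/-- Adjoining one generator uses the binomial estimate `(a + S)^(m+n) ≤ a^m + S^n`, proved by double
induction. -/
theorem exists_pow_span_le {I : r.RIdeal} {E : Set H} (hE : E.Finite)
    (h : E ⊆ radical (I : Set H)) :
    ∃ n : ℕ, span r E ^ n ≤ I := by
  induction E, hE using Set.Finite.induction_on with
  | empty => exact ⟨1, by rw [pow_one]; exact span_le.2 (Set.empty_subset _)⟩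
  | @insert a s _ _ ih =>
    obtain ⟨n, hn⟩ := ih ((Set.subset_insert _ _).trans h)
    obtain ⟨m, -, hm⟩ := h (Set.mem_insert a s)
    refine ⟨m + n, ?_⟩
    have e : span r (insert a s) ≤ prin r a + span r s := span_le.2
      (Set.insert_subset (le_add_left' _ _ (mem_prin a)) ((subset_span s).trans (le_add_right' (prin r a) (span r s))))
    refine (pow_mono e _).trans ?_
    have key : ∀ k l : ℕ, (prin r a + span r s) ^ (k + l) ≤ prin r a ^ k + span r s ^ l := by
      intro k
      induction k with
      | zero => intro l; rw [pow_zero]; exact (le_one _).trans (le_add_left' _ _)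
      | succ k ihk =>
        intro l
        induction l with
        | zero => rw [pow_zero]; exact (le_one _).trans (le_add_right' _ _)
        | succ l ihl =>
          have e1 : (prin r a + span r s) ^ (k + 1 + (l + 1)) =
              prin r a * (prin r a + span r s) ^ (k + (l + 1)) +
                span r s * (prin r a + span r s) ^ (k + 1 + l) := by ring
          rw [e1]
          refine add_le.2 ⟨(mul_mono le_rfl (ihk (l + 1))).trans ?_, (mul_mono le_rfl ihl).trans ?_⟩
          · rw [mul_add, ← pow_succ']
            exact add_le.2 ⟨le_add_left' _ _, (mul_le_right _ _).trans (le_add_right' _ _)⟩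
          · rw [mul_add, ← pow_succ']
            exact add_le.2 ⟨(mul_le_right _ _).trans (le_add_left' _ _), le_add_right' _ _⟩
    refine (key m n).trans (add_le.2 ⟨?_, hn⟩)
    rw [← prin_pow, prin_le]; exact hm

/-- The radical of an `r`-ideal as an `r`-ideal. -/
def rad (hfin : r.Finitary) (I : r.RIdeal) : r.RIdeal := ⟨radical (I : Set H),
  isIdeal_of_finite hfin fun E hE hEf => by
    obtain ⟨n, hn⟩ := exists_pow_span_le hEf hE
    -- The exponent `n` may be zero, while membership in the radical requires a positive one.
    refine ⟨span r E, subset_span E, fun x hx => ⟨n + 1, n.succ_pos, hn ?_⟩⟩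
    rw [pow_succ]
    exact mul_mem_right x (pow_mem_pow hx n)⟩

theorem le_rad (hfin : r.Finitary) (I : r.RIdeal) : I ≤ rad hfin I :=
  fun x hx => ⟨1, one_pos, by rwa [pow_one]⟩

theorem rad_rad (hfin : r.Finitary) (I : r.RIdeal) : (rad hfin I).Rad := by
  rintro n x hn ⟨m, hm, h⟩
  exact ⟨n * m, Nat.mul_pos hn hm, by rwa [pow_mul]⟩

theorem Rad.rad_le {hfin : r.Finitary} {I J : r.RIdeal} (hJ : J.Rad) (h : I ≤ J) :
    rad hfin I ≤ J := by
  rintro x ⟨n, hn, hx⟩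
  exact hJ n x hn (h hx)

/-! ### Localization and Nakayama -/

/-- The localization of `X` at the prime `N`, contracted to `H`. -/
def loc (hfin : r.Finitary) {N : r.RIdeal} (hN : N.Prim) (X : r.RIdeal) : r.RIdeal :=
  ⟨{x | ∃ s, s ∉ N ∧ s * x ∈ X}, isIdeal_of_finite hfin fun E hE hEf => by
    have h : ∃ s, s ∉ N ∧ ∀ x ∈ E, s * x ∈ X := by
      induction E, hEf using Set.Finite.induction_on with
      | empty => exact ⟨1, hN.1, by simp⟩
      | @insert a t _ _ ih =>
        obtain ⟨s, hs, h⟩ := ih ((Set.subset_insert _ _).trans hE)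
        obtain ⟨u, hu, h'⟩ := hE (Set.mem_insert a t)
        refine ⟨s * u, hN.mul_notMem hs hu, ?_⟩
        rintro x (rfl | hx)
        · rw [mul_assoc]; exact mul_mem_left _ h'
        · rw [mul_right_comm]; exact mul_mem_right _ (h x hx)
    obtain ⟨s, hs, h⟩ := h
    refine ⟨span r E, subset_span E, fun x hx => ⟨s, hs, ?_⟩⟩
    exact (prin_mul_span_le.2 h) (mul_mem_mul (mem_prin s) hx)⟩

section loc

variable {hfin : r.Finitary} {N : r.RIdeal} {hN : N.Prim} {X Y : r.RIdeal}

theorem le_loc : X ≤ loc hfin hN X := fun x hx => ⟨1, hN.1, by rwa [one_mul]⟩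

theorem mul_mem_loc {s x : H} (hs : s ∉ N) (h : s * x ∈ loc hfin hN X) : x ∈ loc hfin hN X := by
  obtain ⟨t, ht, h⟩ := h
  exact ⟨t * s, hN.mul_notMem ht hs, by rwa [mul_assoc]⟩

theorem le_loc_of_mul {A : r.RIdeal} {s : H} (hs : s ∉ N) (h : prin r s * A ≤ loc hfin hN X) :
    A ≤ loc hfin hN X := fun _ hx => mul_mem_loc hs (h (mul_mem_mul (mem_prin s) hx))

theorem loc_le_loc (h : X ≤ loc hfin hN Y) : loc hfin hN X ≤ loc hfin hN Y := by
  rintro x ⟨s, hs, hx⟩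
  exact mul_mem_loc hs (h hx)

theorem loc_mul_le {A B : r.RIdeal} (hA : A ≤ loc hfin hN X) (hB : B ≤ loc hfin hN Y) :
    A * B ≤ loc hfin hN (X * Y) := by
  refine mul_le.2 fun a ha b hb => ?_
  obtain ⟨s, hs, h⟩ := hA ha
  obtain ⟨t, ht, h'⟩ := hB hb
  refine ⟨s * t, hN.mul_notMem hs ht, ?_⟩
  rw [mul_mul_mul_comm]
  exact mul_mem_mul h h'

theorem loc_self_le : loc hfin hN N ≤ N := by
  rintro x ⟨s, hs, h⟩
  exact (hN.2 s x h).resolve_left hs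

theorem loc_le_of_prim {P : r.RIdeal} (hP : P.Prim) (hPN : P ≤ N) : loc hfin hN P ≤ P := by
  rintro x ⟨s, hs, h⟩
  exact (hP.2 s x h).resolve_left fun h1 => hs (hPN h1)

theorem le_loc_of_not_le (h : ¬ X ≤ N) (A : r.RIdeal) : A ≤ loc hfin hN X := by
  obtain ⟨s, hs, hsN⟩ := not_le_iff.1 h
  exact fun x _ => ⟨s, hsN, mul_mem_right x hs⟩

theorem FG.exists_of_le_loc {C : r.RIdeal} (hC : C.FG) (h : C ≤ loc hfin hN X) :
    ∃ s, s ∉ N ∧ prin r s * C ≤ X := by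
  obtain ⟨E, hE, rfl⟩ := hC
  simp only [prin_mul_span_le]
  replace h := span_le.1 h
  induction E, hE using Set.Finite.induction_on with
  | empty => exact ⟨1, hN.1, by simp⟩
  | @insert a t _ _ ih =>
    obtain ⟨s, hs, h'⟩ := ih ((Set.subset_insert _ _).trans h)
    obtain ⟨u, hu, h''⟩ := h (Set.mem_insert a t)
    refine ⟨s * u, hN.mul_notMem hs hu, ?_⟩
    rintro x (rfl | hx)
    · rw [mul_assoc]; exact mul_mem_left _ h''
    · rw [mul_right_comm]; exact mul_mem_right _ (h' x hx)

/-- A radical `r`-ideal agrees locally at a prime minimal above it with that prime. -/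
theorem Rad.le_loc {R : r.RIdeal} (hR : R.Rad)
    (hmin : ∀ Q : r.RIdeal, Q.Prim → R ≤ Q → Q ≤ N → N ≤ Q) : N ≤ loc hfin hN R := by
  intro x hx
  by_contra hc
  -- A prime avoiding the products of powers of `x` with elements outside `N` lies in `N` but misses
  -- `x`. If it also contains `R`, this contradicts minimality of `N`.
  let S : Submonoid H :=
    { carrier := {y | ∃ s n, s ∉ N ∧ y = s * x ^ n}
      one_mem' := ⟨1, 0, hN.1, by simp⟩
      mul_mem' := by
        rintro _ _ ⟨s, n, hs, rfl⟩ ⟨t, m, ht, rfl⟩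
        exact ⟨s * t, n + m, hN.mul_notMem hs ht, by rw [pow_add, mul_mul_mul_comm]⟩ }
  obtain ⟨Q, hQ, hRQ, hQS⟩ := exists_prim_disjoint hfin S (I := R) (by
    rintro _ ⟨s, n, hs, rfl⟩ h
    refine hc ⟨s, hs, hR (n + 1) _ n.succ_pos ?_⟩
    have e : (s * x) ^ (n + 1) = s * x ^ n * (s ^ n * x) := by
      rw [mul_pow, pow_succ, pow_succ]; ac_rfl
    rw [e]
    exact mul_mem_right _ h)
  have hQN : Q ≤ N := fun y hy => by
    by_contra hyN
    exact hQS y ⟨y, 0, hyN, by simp⟩ hy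
  exact hQS x ⟨1, 1, hN.1, by simp⟩ (hmin Q hQ hRQ hQN hx)

/-- A Nakayama lemma for invertible `r`-ideals; this is where modularity enters. -/
theorem Inv.exists_mul_le (hmod : r.Modular) {A B C : r.RIdeal} (hC : C.Inv) (hB : B ≤ N) {s : H}
    (hs : s ∉ N) (h : prin r s * C ≤ A + C * B) : ∃ t, t ∉ N ∧ prin r t * C ≤ A := by
  have h1 : prin r s * C ≤ C * (B + colon A C) := by
    intro x hx
    -- Modularity replaces `A` by `A ∩ C`, which lies in `C * (A : C)` because `C` is invertible.
    -- Cancelling `C` puts `s` into `B + (A : C)`, so the colon ideal is not inside `N`.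
    have h2 := hmod (C * B : r.RIdeal) A C (C * B).2 A.2 C.2 (mul_le_left C B)
      ⟨by rw [Set.union_comm]; exact h hx, mul_le_right _ _ hx⟩
    have h3 : span r (((C * B : r.RIdeal) : Set H) ∪ ((A : Set H) ∩ C)) ≤ C * (B + colon A C) := by
      refine span_le.2 (Set.union_subset (mul_mono le_rfl (le_add_left' _ _)) ?_)
      rintro y ⟨hyA, hyC⟩
      obtain ⟨D, hD⟩ := hC.dvd (prin_le.2 hyC)
      have hDA : D ≤ colon A C := le_colon.2 (by rw [mul_comm, ← hD, prin_le]; exact hyA)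
      exact mul_mono le_rfl (hDA.trans (le_add_right' _ _)) (hD ▸ mem_prin y)
    exact h3 h2
  have h4 : prin r s ≤ B + colon A C := hC.cancel_le (by rwa [mul_comm C])
  have h5 : ¬ colon A C ≤ N := fun hc => hs (add_le.2 ⟨hB, hc⟩ (prin_le.1 h4))
  obtain ⟨t, ht, htN⟩ := not_le_iff.1 h5
  exact ⟨t, htN, prin_mul_le.2 ht⟩

theorem Inv.le_loc_of_le_add (hmod : r.Modular) {A B C : r.RIdeal} (hC : C.Inv) (hB : B ≤ N)
    (h : C ≤ loc hfin hN (A + C * B)) : C ≤ loc hfin hN A := by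
  obtain ⟨s, hs, h⟩ := (hC.fg hfin).exists_of_le_loc h
  obtain ⟨t, ht, h⟩ := hC.exists_mul_le hmod hB hs h
  exact le_loc_of_mul ht (h.trans le_loc)

end loc

end RIdeal

end WeakIdealSystem

/-! ### From factorization properties to `PrimesGood` -/

namespace WeakIdealSystem

namespace RIdeal

variable {H : Type*} [CommMonoid H] {r : WeakIdealSystem H}

/-- Every regular `r`-ideal is generated by the invertible `r`-ideals it contains. -/
def GenByInv (r : WeakIdealSystem H) : Prop :=
  ∀ I K : r.RIdeal, I.Reg → (∀ D : r.RIdeal, D.Inv → D ≤ I → D ≤ K) → I ≤ K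

theorem genByInv_of_isUnionOfInvertibles
    (hinv : ∀ I : Set H, r.IsIdeal I → r.IsRegularSet I → r.IsUnionOfInvertibles I) :
    GenByInv r := by
  intro I K hI h
  obtain ⟨S, hS, hIS⟩ := hinv I I.2 hI
  have h1 : I = span r (⋃₀ S) := SetLike.coe_injective hIS
  have h2 : ⋃₀ S ⊆ (I : Set H) := h1 ▸ subset_span _
  rw [h1, span_le]
  refine Set.sUnion_subset fun J hJ => ?_
  exact h ⟨J, (hS J hJ).1⟩ (inv_iff.2 (hS J hJ).2) ((Set.subset_sUnion_of_mem hJ).trans h2)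

theorem GenByInv.exists_of_not_le (hgen : GenByInv r) {I K : r.RIdeal} (hI : I.Reg) (h : ¬ I ≤ K) :
    ∃ D : r.RIdeal, D.Inv ∧ D ≤ I ∧ ¬ D ≤ K := by
  by_contra! hc
  exact h (hgen I K hI hc)

/-- Regular prime `r`-ideals are maximal and contain invertible radical `r`-ideals. -/
def PrimesGood (r : WeakIdealSystem H) : Prop :=
  ∀ P : r.RIdeal, P.Prim → P.Reg → P.Maxi ∧ ∃ J : r.RIdeal, J ≤ P ∧ J.Rad ∧ J.Inv

theorem maxi_of_forall_le (hfin : r.Finitary) {P : r.RIdeal} (hP : P.Prim)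
    (h : ∀ M : r.RIdeal, M.Prim → P ≤ M → M ≤ P) : P.Maxi := by
  obtain ⟨M, hM, hMp, hPM⟩ := exists_maxi hfin hP.1
  rwa [le_antisymm hPM (h M hMp hPM)]

/-- Suppose `P` lies strictly inside a prime `M`. The radical `K` of `J + C` divides `J = K A`, with
`A ≤ P`. The radical `Q` of `A + K` divides both factors, so `J` has the form `X Q` with `X ^ 2 ≤
J`. Radicality gives `X ≤ X Q`, and cancelling `X` forces `Q = H`, although `Q ≤ M`. -/
theorem primesGood_of_inv_rad (hfin : r.Finitary) (hgen : GenByInv r)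
    (h : ∀ I : r.RIdeal, I.Reg → I.FG → (rad hfin I).Inv) : PrimesGood r := by
  intro P hP hPreg
  obtain ⟨y, hyP, hy⟩ := hPreg
  have hJ := h (prin r y) ⟨y, mem_prin y, hy⟩ (fg_prin y)
  have hJrad := rad_rad hfin (prin r y)
  have hJP : rad hfin (prin r y) ≤ P := hP.rad.rad_le (prin_le.2 hyP)
  generalize rad hfin (prin r y) = J at hJ hJrad hJP
  refine ⟨maxi_of_forall_le hfin hP fun M hM hPM => ?_, J, hJP, hJrad, hJ⟩
  by_contra hMP
  obtain ⟨C, hC, hCM, hCP⟩ := hgen.exists_of_not_le (hJ.reg.mono (hJP.trans hPM)) hMP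
  have hK : (rad hfin (J + C)).Inv :=
    h _ (hJ.reg.mono (le_add_left' _ _)) ((hJ.fg hfin).add (hC.fg hfin))
  have hKM : rad hfin (J + C) ≤ M := hM.rad.rad_le (add_le.2 ⟨hJP.trans hPM, hCM⟩)
  have hJCK := le_rad hfin (J + C)
  generalize rad hfin (J + C) = K at hK hKM hJCK
  obtain ⟨A, rfl⟩ := hK.dvd ((le_add_left' _ _).trans hJCK)
  have hKP : ¬ K ≤ P := fun hc => hCP (((le_add_right' _ _).trans hJCK).trans hc)
  have hAP : A ≤ P := (hP.le_or_le hJP).resolve_left hKP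
  have hA : A.Inv := hJ.of_mul_right
  have hQ : (rad hfin (A + K)).Inv :=
    h _ (hK.reg.mono (le_add_right' _ _)) ((hA.fg hfin).add (hK.fg hfin))
  have hQM : rad hfin (A + K) ≤ M := hM.rad.rad_le (add_le.2 ⟨hAP.trans hPM, hKM⟩)
  have hAKQ := le_rad hfin (A + K)
  generalize rad hfin (A + K) = Q at hQ hQM hAKQ
  obtain ⟨A', rfl⟩ := hQ.dvd ((le_add_left' _ _).trans hAKQ)
  obtain ⟨K', rfl⟩ := hQ.dvd ((le_add_right' _ _).trans hAKQ)
  have e : Q * K' * (Q * A') = Q * A' * K' * Q := by ring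
  rw [e] at hJ hJrad
  have h2 : (Q * A' * K') ^ 2 ≤ Q * A' * K' * Q := by
    have : (Q * A' * K') ^ 2 = Q * A' * K' * Q * (A' * K') := by ring
    rw [this]; exact mul_le_left _ _
  have h3 : Q * A' * K' * 1 ≤ Q * A' * K' * Q := by
    rw [mul_one]; exact hJrad.le_of_pow two_pos h2
  exact hM.1 (hQM (one_le_iff.1 (hJ.of_mul_left.cancel_le h3)))

theorem Prim.exists_mem_le {P : r.RIdeal} (hP : P.Prim) {l : List r.RIdeal} (h : l.prod ≤ P) :
    ∃ J ∈ l, J ≤ P := by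
  induction l with
  | nil => exact absurd (one_le_iff.1 h) hP.1
  | cons a t ih =>
    rw [List.prod_cons] at h
    rcases hP.le_or_le h with h | h
    · exact ⟨a, List.mem_cons_self, h⟩
    · obtain ⟨J, hJ, hJP⟩ := ih h
      exact ⟨J, List.mem_cons_of_mem _ hJ, hJP⟩

theorem Inv.of_mem_prod {l : List r.RIdeal} (h : l.prod.Inv) {J : r.RIdeal} (hJ : J ∈ l) :
    J.Inv := by
  obtain ⟨C, hC⟩ := List.dvd_prod hJ
  rw [hC] at h
  exact h.of_mul_left

theorem prod_le_of_mem {l : List r.RIdeal} {J : r.RIdeal} (hJ : J ∈ l) : l.prod ≤ J := by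
  obtain ⟨C, hC⟩ := List.dvd_prod hJ
  rw [hC]
  exact mul_le_left _ _

section loc

variable {hfin : r.Finitary} {N : r.RIdeal} {hN : N.Prim}

/-- Two factors inside `N` would put the product into `N * N`. So exactly one factor lies in `N`,
and the others are trivial locally. -/
theorem exists_mem_le_loc_prod {l : List r.RIdeal} (h : l.prod ≤ N)
    (h2 : ¬ l.prod ≤ loc hfin hN (N * N)) : ∃ R ∈ l, R ≤ loc hfin hN l.prod := by
  induction l with
  | nil => exact absurd (one_le_iff.1 h) hN.1
  | cons a t ih =>
    rw [List.prod_cons] at h h2 ⊢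
    by_cases ha : a ≤ N
    · have ht : ¬ t.prod ≤ N := fun ht => h2 ((mul_mono ha ht).trans le_loc)
      refine ⟨a, List.mem_cons_self, ?_⟩
      have := loc_mul_le (hfin := hfin) (hN := hN) (le_loc (X := a)) (le_loc_of_not_le ht 1)
      rwa [mul_one] at this
    · have ht := (hN.le_or_le h).resolve_left ha
      obtain ⟨R, hR, h3⟩ := ih ht fun hc => h2 ((mul_le_right _ _).trans hc)
      refine ⟨R, List.mem_cons_of_mem _ hR, h3.trans (loc_le_loc ?_)⟩
      have := loc_mul_le (hfin := hfin) (hN := hN) (le_loc_of_not_le ha 1) (le_loc (X := t.prod))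
      rwa [one_mul] at this

theorem le_loc_prod (hid : N ≤ loc hfin hN (N * N)) {l : List r.RIdeal}
    (h : ∀ R ∈ l, N ≤ loc hfin hN R) : N ≤ loc hfin hN l.prod := by
  induction l with
  | nil => exact (le_one _).trans le_loc
  | cons a t ih =>
    rw [List.prod_cons]
    refine hid.trans (loc_le_loc (loc_mul_le (h a List.mem_cons_self) (ih fun R hR => ?_)))
    exact h R (List.mem_cons_of_mem _ hR)

/-- For `j ∈ J`, some multiple `t j` with `t ∉ N` generates `D A`, where `A ≤ P` because `D` is not
inside `P`. If `J` were radical, squaring would place `A` in `J` locally, so `J ≤ D J` locally.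
Cancelling `J` puts an element outside `N` into `D`. -/
theorem Rad.not_le_loc_of_inv {P D J : r.RIdeal} (hP : P.Prim) (hPN : P ≤ N) (hD : D.Inv)
    (hDN : D ≤ N) (hDP : ¬ D ≤ P) (hND : N ≤ loc hfin hN D) (hJ : J.Inv) (hJP : J ≤ P) :
    ¬ J.Rad := by
  intro hJrad
  have h : J ≤ loc hfin hN (D * J) := by
    intro j hj
    obtain ⟨t, ht, htj⟩ := hND (hPN (hJP hj))
    obtain ⟨A, hA⟩ := hD.dvd (prin_le.2 htj)
    have hDAJ : D * A ≤ J := by rw [← hA, prin_le]; exact mul_mem_left t hj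
    have hAP : A ≤ P := (hP.le_or_le (hDAJ.trans hJP)).resolve_left hDP
    have hAJ : A ≤ loc hfin hN J := by
      intro a ha
      obtain ⟨s, hs, hsa⟩ := hND (hPN (hAP ha))
      refine ⟨s, hs, hJrad 2 _ two_pos ?_⟩
      rw [pow_two]
      exact hDAJ (mul_mem_mul hsa (mul_mem_left s ha))
    apply mul_mem_loc ht
    rw [← prin_le, hA]
    exact loc_mul_le RIdeal.le_loc hAJ
  obtain ⟨u, hu, h⟩ := (hJ.fg hfin).exists_of_le_loc h
  rw [mul_comm, mul_comm D] at h
  exact hu (hDN (prin_le.1 (hJ.cancel_le h)))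

end loc

theorem primesGood_of_prod_rad (hfin : r.Finitary) (hmod : r.Modular) (hgen : GenByInv r)
    (h : ∀ I : r.RIdeal, I.Reg → ∃ l : List r.RIdeal, (∀ J ∈ l, J.Rad) ∧ I = l.prod) :
    PrimesGood r := by
  intro P hP hPreg
  obtain ⟨J, hJP, hJrad, hJ⟩ : ∃ J : r.RIdeal, J ≤ P ∧ J.Rad ∧ J.Inv := by
    obtain ⟨y, hyP, hy⟩ := hPreg
    obtain ⟨l, hl, hyl⟩ := h (prin r y) (inv_prin hy).reg
    obtain ⟨J, hJl, hJP⟩ := hP.exists_mem_le (hyl ▸ prin_le.2 hyP : l.prod ≤ P)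
    exact ⟨J, hJP, hl J hJl, Inv.of_mem_prod (hyl ▸ inv_prin hy) hJl⟩
  refine ⟨maxi_of_forall_le hfin hP fun M hM hPM => ?_, J, hJP, hJrad, hJ⟩
  by_contra hMP
  obtain ⟨C, hC, hCM, hCP⟩ := hgen.exists_of_not_le (hPreg.mono hPM) hMP
  obtain ⟨N, hN, hPCN, -, hmin⟩ := exists_minimal_prim hM (add_le.2 ⟨hPM, hCM⟩)
  obtain ⟨hPN, hCN⟩ := add_le.1 hPCN
  -- If `N` is locally idempotent, each radical factor of `P + C * C` contains `P` and `C`, hence is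
  -- `N` locally, and so is the product. Thus `C ≤ P + C * C` locally, and Nakayama gives `C ≤ P`.
  by_cases hid : N ≤ loc hfin hN (N * N)
  · obtain ⟨l, hl, hPl⟩ := h (P + C * C) (hPreg.mono (le_add_left' _ _))
    have hle : ∀ R ∈ l, N ≤ loc hfin hN R := by
      intro R hR
      have hPCR : P + C * C ≤ R := hPl ▸ prod_le_of_mem hR
      obtain ⟨h1, h2⟩ := add_le.1 hPCR
      refine (hl R hR).le_loc fun Q hQ hRQ hQN => hmin Q hQ (add_le.2 ⟨h1.trans hRQ, ?_⟩) hQN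
      exact ((hl R hR).le_of_pow two_pos (by rwa [pow_two])).trans hRQ
    have h3 : C ≤ loc hfin hN (P + C * C) := hPl ▸ hCN.trans (le_loc_prod hid hle)
    exact hCP ((hC.le_loc_of_le_add hmod hCN h3).trans (loc_le_of_prim hP hPN))
  · obtain ⟨D, hD, hDN, hDN2⟩ := hgen.exists_of_not_le (hPreg.mono hPN) hid
    -- Here `D` generates `N` locally: for invertible `K ≤ N`, a single radical factor of `D + K *
    -- K` matters locally, and it contains `K`. Nakayama then removes `K * K`.
    have hND : N ≤ loc hfin hN D := by
      refine hgen _ _ (hPreg.mono hPN) fun K hK hKN => ?_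
      obtain ⟨l, hl, hKl⟩ := h (D + K * K) (hD.reg.mono (le_add_left' _ _))
      have h1 : l.prod ≤ N := hKl ▸ add_le.2 ⟨hDN, (mul_le_left _ _).trans hKN⟩
      have h2 : ¬ l.prod ≤ loc hfin hN (N * N) := fun hc =>
        hDN2 ((le_add_left' _ _).trans (hKl.le.trans hc))
      obtain ⟨R, hR, hRl⟩ := exists_mem_le_loc_prod h1 h2
      have hKR : K ≤ R := (hl R hR).le_of_pow two_pos (by
        rw [pow_two]
        exact (le_add_right' _ _).trans (hKl.le.trans (prod_le_of_mem hR)))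
      refine hK.le_loc_of_le_add hmod hKN ?_
      rw [hKl]
      exact hKR.trans hRl
    have hDP : ¬ D ≤ P := fun hDP => by
      refine hCP (hCN.trans (hND.trans ((loc_le_loc ?_).trans (loc_le_of_prim hP hPN))))
      exact hDP.trans le_loc
    exact Rad.not_le_loc_of_inv hP hPN hD hDN hDP hND hJ hJP hJrad

end RIdeal

end WeakIdealSystem

/-! ### The order at a regular maximal ideal -/

namespace WeakIdealSystem

variable {H : Type*} [CommMonoid H] {r : WeakIdealSystem H}

namespace RegMax

/-- The `r`-ideal underlying a regular `r`-maximal `r`-ideal. -/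
def ideal (M : r.RegMax) : r.RIdeal := ⟨M.1, M.2.1.1.1⟩

theorem maxi (M : r.RegMax) : M.ideal.Maxi := M.2.1
theorem reg (M : r.RegMax) : M.ideal.Reg := M.2.2
theorem prim (hfin : r.Finitary) (M : r.RegMax) : M.ideal.Prim := M.maxi.prim hfin

/-- Localization at a regular `r`-maximal `r`-ideal. -/
def loc (hfin : r.Finitary) (M : r.RegMax) (X : r.RIdeal) : r.RIdeal := RIdeal.loc hfin
    (M.prim hfin) X

end RegMax

namespace RIdeal

theorem exists_regMax (hfin : r.Finitary) {I : r.RIdeal} (hI : I.Reg) (h : (1 : H) ∉ I) :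
    ∃ M : r.RegMax, I ≤ M.ideal := by
  obtain ⟨M, hM, -, hIM⟩ := exists_maxi hfin h
  exact ⟨⟨M, hM, hI.mono hIM⟩, hIM⟩

/-- If `x ∈ I` is not in `K`, the colon of `K` by `x` is proper and regular, so a regular maximal
ideal contains it. No denominator for `x` exists there. -/
theorem le_of_forall_loc (hfin : r.Finitary) {I K : r.RIdeal} (hK : K.Reg)
    (h : ∀ M : r.RegMax, I ≤ M.loc hfin K) : I ≤ K := by
  intro x hx
  by_contra hxK
  have h1 : K ≤ colon K (prin r x) := le_colon.2 (mul_le_left _ _)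
  obtain ⟨M, hM⟩ := exists_regMax hfin (hK.mono h1)
    (fun hc => hxK (by simpa using mem_colon.1 hc x (mem_prin x)))
  obtain ⟨s, hs, hsx⟩ := h M hx
  exact hs (hM (prin_le.1 (le_colon.2 (by rw [← prin_mul, prin_le]; exact hsx))))

theorem Rad.le_loc_regMax {hfin : r.Finitary} (hgood : PrimesGood r) {M : r.RegMax} {R : r.RIdeal}
    (hR : R.Rad)
    (hreg : R.Reg) : M.ideal ≤ M.loc hfin R :=
  hR.le_loc fun Q hQ hRQ hQM =>
    ((hgood Q hQ (hreg.mono hRQ)).1.eq_of_le (M.prim hfin).1 hQM).ge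

section local_generator

variable {hfin : r.Finitary} {M : r.RegMax} {J : r.RIdeal}

theorem pow_le_loc_pow (hMJ : M.ideal ≤ M.loc hfin J) (n : ℕ) : M.ideal ^ n ≤ M.loc hfin (J ^ n)
    := by
  induction n with
  | zero => rw [pow_zero, pow_zero]; exact le_loc
  | succ n ih => rw [pow_succ, pow_succ]; exact loc_mul_le ih hMJ

theorem le_loc_pow_iff (hJM : J ≤ M.ideal) (hMJ : M.ideal ≤ M.loc hfin J) {n : ℕ} {I : r.RIdeal} :
    I ≤ M.loc hfin (M.ideal ^ n) ↔ I ≤ M.loc hfin (J ^ n) :=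
  ⟨fun h => h.trans (loc_le_loc (pow_le_loc_pow hMJ n)),
    fun h => h.trans (loc_le_loc ((pow_mono hJM n).trans le_loc))⟩

/-- For `k ∈ K` outside the next power, a multiple of `k` generates `J ^ n * A` with `A` not inside
`M`, so `A` is trivial locally. -/
theorem pow_le_loc_of_not_le (hJ : J.Inv) (hMJ : M.ideal ≤ M.loc hfin J) {n : ℕ} {K : r.RIdeal}
    (h : K ≤ M.loc hfin (J ^ n)) (h' : ¬ K ≤ M.loc hfin (J ^ (n + 1))) : J ^ n ≤ M.loc hfin K := by
  obtain ⟨k, hk, hkn⟩ := not_le_iff.1 h'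
  obtain ⟨s, hs, hsk⟩ := h hk
  obtain ⟨A, hA⟩ := (hJ.pow n).dvd (prin_le.2 hsk)
  have hAM : ¬ A ≤ M.ideal := fun hc => hkn <| mul_mem_loc hs <| by
    rw [← prin_le, hA, pow_succ]
    exact loc_mul_le le_loc (hc.trans hMJ)
  obtain ⟨a, ha, haM⟩ := not_le_iff.1 hAM
  refine le_loc_of_mul haM (le_trans ?_ le_loc)
  refine (mul_mono (prin_le.2 ha) le_rfl).trans ?_
  rw [mul_comm, ← hA, prin_le]
  exact mul_mem_left s hk

theorem le_of_pow_le_loc_pow (hJ : J.Inv) (hJM : J ≤ M.ideal) {a b : ℕ}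
    (h : J ^ a ≤ M.loc hfin (J ^ b)) : b ≤ a := by
  by_contra! hab
  obtain ⟨s, hs, h⟩ := ((hJ.pow a).fg hfin).exists_of_le_loc h
  have h1 : J ^ a * prin r s ≤ J ^ a * J := by
    rw [mul_comm, ← pow_succ]
    exact h.trans (pow_le_pow_right hab)
  exact hs (hJM (prin_le.1 ((hJ.pow a).cancel_le h1)))

theorem le_loc_pow_anti {a b : ℕ} (hab : a ≤ b) {I : r.RIdeal}
    (h : I ≤ M.loc hfin (J ^ b)) : I ≤ M.loc hfin (J ^ a) :=
  h.trans (loc_le_loc ((pow_le_pow_right hab).trans le_loc))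

theorem exists_split {I : r.RIdeal} (h : ∃ n, ¬ I ≤ M.loc hfin (J ^ n)) :
    ∃ n, I ≤ M.loc hfin (J ^ n) ∧ ¬ I ≤ M.loc hfin (J ^ (n + 1)) := by
  classical
  obtain ⟨k, hk⟩ : ∃ k, Nat.find h = k + 1 := by
    refine Nat.exists_eq_succ_of_ne_zero fun h0 => ?_
    have := Nat.find_spec h
    rw [h0, pow_zero] at this
    exact this ((le_one I).trans le_loc)
  refine ⟨k, ?_, hk ▸ Nat.find_spec h⟩
  by_contra hc
  have := Nat.find_min' h hc
  omega

/-- The intersection of the localized powers of `J` is prime, since exponents add. If it contained a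
regular ideal it would be maximal, hence `M`, which is impossible as `J` is not locally in `J ^ 2`.
-/
theorem exists_not_le_loc_pow (hgood : PrimesGood r) (hJ : J.Inv) (hJM : J ≤ M.ideal)
    (hMJ : M.ideal ≤ M.loc hfin J) {I : r.RIdeal} (hI : I.Reg) :
    ∃ n, ¬ I ≤ M.loc hfin (J ^ n) := by
  by_contra! hc
  have hid : r.IsIdeal (⋂ n, (M.loc hfin (J ^ n) : Set H)) := by
    refine Set.Subset.antisymm (Set.subset_iInter fun n => ?_) (r.subset_cl _)
    conv_rhs => rw [← cl_coe]
    exact r.cl_mono (Set.iInter_subset _ n)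
  set P : r.RIdeal := ⟨_, hid⟩ with hPdef
  have memP : ∀ x, x ∈ P ↔ ∀ n, x ∈ M.loc hfin (J ^ n) := fun x => Set.mem_iInter
  have hPM : P ≤ M.ideal := fun x hx => by
    have := (memP x).1 hx 1
    rw [pow_one] at this
    exact loc_self_le (loc_le_loc (hJM.trans le_loc) this)
  have hP : P.Prim := by
    refine ⟨fun h => (M.prim hfin).1 (hPM h), fun x y hxy => ?_⟩
    by_contra! hcon
    simp only [memP, not_forall, ← prin_le (r := r)] at hcon
    obtain ⟨k, hk, hk'⟩ := exists_split hcon.1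
    obtain ⟨l, hl, hl'⟩ := exists_split hcon.2
    have h1 := loc_mul_le (pow_le_loc_of_not_le hJ hMJ hk hk') (pow_le_loc_of_not_le hJ hMJ hl hl')
    rw [← pow_add, ← prin_mul] at h1
    have h2 := h1.trans (loc_le_loc (prin_le.2 ((memP _).1 hxy (k + l + 1))))
    have := le_of_pow_le_loc_pow hJ hJM h2
    omega
  have hIP : I ≤ P := fun x hx => (memP x).2 fun n => hc n hx
  have hMP := ((hgood P hP (hI.mono hIP)).1.eq_of_le (M.prim hfin).1 hPM).ge
  have := le_of_pow_le_loc_pow (hfin := hfin) hJ hJM (a := 1) (b := 2) (by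
    rw [pow_one]
    exact fun x hx => (memP x).1 (hMP (hJM hx)) 2)
  omega

end local_generator

/-- The order of `I` at `M`: the largest `n` for which `I` is locally contained in `M ^ n`. -/
noncomputable def ord (hfin : r.Finitary) (M : r.RegMax) (I : r.RIdeal) : ℕ :=
  sInf {n | ¬ I ≤ M.loc hfin (M.ideal ^ (n + 1))}

section ord

variable {hfin : r.Finitary}

/-- Regularity of `I` makes the set in the infimum nonempty, so the value is genuine and not the
default `0`. Powers of `M` may be replaced locally by those of `J`. -/
theorem le_ord_iff (hgood : PrimesGood r) {M : r.RegMax} {I : r.RIdeal} (hI : I.Reg) {n : ℕ} :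
    n ≤ ord hfin M I ↔ I ≤ M.loc hfin (M.ideal ^ n) := by
  obtain ⟨-, J, hJM, hJrad, hJ⟩ := hgood M.ideal (M.prim hfin) M.reg
  have hMJ := hJrad.le_loc_regMax (hfin := hfin) hgood (M := M) hJ.reg
  obtain ⟨k, hk, hk'⟩ := exists_split (exists_not_le_loc_pow hgood hJ hJM hMJ hI)
  have hord : ord hfin M I = k := by
    refine le_antisymm (Nat.sInf_le ?_) (le_csInf ⟨k, ?_⟩ fun m hm => ?_)
    · exact fun h => hk' ((le_loc_pow_iff hJM hMJ).1 h)
    · exact fun h => hk' ((le_loc_pow_iff hJM hMJ).1 h)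
    · by_contra! hc
      exact hm ((le_loc_pow_iff hJM hMJ).2 (le_loc_pow_anti hc hk))
  rw [hord, le_loc_pow_iff hJM hMJ]
  refine ⟨fun h => le_loc_pow_anti h hk, fun h => ?_⟩
  by_contra! hc
  exact hk' (le_loc_pow_anti hc h)

theorem pow_ord_le_loc (hgood : PrimesGood r) {M : r.RegMax} {I : r.RIdeal} (hI : I.Reg) :
    M.ideal ^ ord hfin M I ≤ M.loc hfin I := by
  obtain ⟨-, J, hJM, hJrad, hJ⟩ := hgood M.ideal (M.prim hfin) M.reg
  have hMJ := hJrad.le_loc_regMax (hfin := hfin) hgood (M := M) hJ.reg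
  have h1 := (le_ord_iff hgood (hfin := hfin) (M := M) hI).1 le_rfl
  have h2 := (le_ord_iff hgood (hfin := hfin) (M := M) hI (n := ord hfin M I + 1)).not.1 (by omega)
  rw [le_loc_pow_iff hJM hMJ] at h1 h2
  exact (pow_le_loc_pow hMJ _).trans (loc_le_loc (pow_le_loc_of_not_le hJ hMJ h1 h2))

theorem ord_pow_self (hgood : PrimesGood r) {M : r.RegMax} (n : ℕ) :
    ord hfin M (M.ideal ^ n) = n := by
  obtain ⟨-, J, hJM, hJrad, hJ⟩ := hgood M.ideal (M.prim hfin) M.reg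
  have hMJ := hJrad.le_loc_regMax (hfin := hfin) hgood (M := M) hJ.reg
  refine le_antisymm ?_ ((le_ord_iff hgood (M.reg.pow n)).2 le_loc)
  have h1 := (le_ord_iff hgood (hfin := hfin) (M := M) (M.reg.pow n)).1 le_rfl
  rw [le_loc_pow_iff hJM hMJ] at h1
  exact le_of_pow_le_loc_pow hJ hJM ((pow_mono hJM n).trans h1)

theorem ord_le_ord (hgood : PrimesGood r) {M : r.RegMax} {I K : r.RIdeal} (hI : I.Reg) (hK : K.Reg)
    (h : I ≤ M.loc hfin K) : ord hfin M K ≤ ord hfin M I :=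
  (le_ord_iff hgood hI).2 (h.trans (loc_le_loc ((le_ord_iff hgood hK).1 le_rfl)))

theorem ord_anti (hgood : PrimesGood r) {M : r.RegMax} {I K : r.RIdeal} (hI : I.Reg)
    (h : I ≤ K) : ord hfin M K ≤ ord hfin M I := ord_le_ord hgood hI (hI.mono h) (h.trans le_loc)

theorem le_loc_of_ord_le (hgood : PrimesGood r) {M : r.RegMax} {I K : r.RIdeal} (hI : I.Reg)
    (hK : K.Reg)
    (h : ord hfin M K ≤ ord hfin M I) : I ≤ M.loc hfin K :=
  ((le_ord_iff hgood hI).1 h).trans (loc_le_loc (pow_ord_le_loc hgood hK))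

theorem le_iff_ord (hgood : PrimesGood r) {I K : r.RIdeal} (hI : I.Reg) (hK : K.Reg) :
    I ≤ K ↔ ∀ M, ord hfin M K ≤ ord hfin M I :=
  ⟨fun h _ => ord_anti hgood hI h,
    fun h => le_of_forall_loc hfin hK fun M => le_loc_of_ord_le hgood hI hK (h M)⟩

theorem ord_mul (hgood : PrimesGood r) {M : r.RegMax} {I K : r.RIdeal} (hI : I.Reg) (hK : K.Reg) :
    ord hfin M (I * K) = ord hfin M I + ord hfin M K := by
  apply le_antisymm
  · have h := loc_mul_le (pow_ord_le_loc hgood (hfin := hfin) (M := M) hI)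
      (pow_ord_le_loc hgood (hfin := hfin) (M := M) hK)
    rw [← pow_add] at h
    have := ord_le_ord (hfin := hfin) hgood (M.reg.pow _) (hI.mul hK) h
    rwa [ord_pow_self hgood] at this
  · rw [le_ord_iff hgood (hI.mul hK), pow_add]
    exact loc_mul_le ((le_ord_iff hgood hI).1 le_rfl) ((le_ord_iff hgood hK).1 le_rfl)

theorem ord_add (hgood : PrimesGood r) {M : r.RegMax} {I K : r.RIdeal} (hI : I.Reg) (hK : K.Reg) :
    ord hfin M (I + K) = min (ord hfin M I) (ord hfin M K) := by
  have hIK : (I + K).Reg := hI.mono (le_add_left' _ _)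
  apply le_antisymm
  · exact le_min (ord_anti hgood hI (le_add_left' _ _)) (ord_anti hgood hK (le_add_right' _ _))
  · rw [le_ord_iff hgood hIK, add_le, ← le_ord_iff hgood hI, ← le_ord_iff hgood hK]
    exact ⟨min_le_left _ _, min_le_right _ _⟩

theorem ord_one (hgood : PrimesGood r) {M : r.RegMax} : ord hfin M 1 = 0 := by
  simpa using ord_pow_self (hfin := hfin) hgood (M := M) 0

theorem ord_pow (hgood : PrimesGood r) {M : r.RegMax} {I : r.RIdeal} (hI : I.Reg) (n : ℕ) :
    ord hfin M (I ^ n) = n * ord hfin M I := by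
  induction n with
  | zero => simp [ord_one hgood]
  | succ n ih => rw [pow_succ, ord_mul hgood (hI.pow n) hI, ih, Nat.succ_mul]

theorem one_le_ord_iff (hgood : PrimesGood r) {M : r.RegMax} {I : r.RIdeal} (hI : I.Reg) :
    1 ≤ ord hfin M I ↔ I ≤ M.ideal := by
  rw [le_ord_iff hgood hI, pow_one]
  exact ⟨fun h => h.trans loc_self_le, fun h => h.trans le_loc⟩

theorem Rad.ord_le_one (hgood : PrimesGood r) {M : r.RegMax} {R : r.RIdeal} (hR : R.Rad)
    (hreg : R.Reg) :
    ord hfin M R ≤ 1 := by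
  have := ord_le_ord (hfin := hfin) hgood M.reg hreg (hR.le_loc_regMax hgood hreg)
  have h1 := ord_pow_self (hfin := hfin) hgood (M := M) 1
  rw [pow_one] at h1
  omega

theorem exists_inv_ord_eq (hgood : PrimesGood r) (hgen : GenByInv r) (M : r.RegMax) {I : r.RIdeal}
    (hI : I.Reg) :
    ∃ C : r.RIdeal, C.Inv ∧ C ≤ I ∧ ord hfin M C = ord hfin M I := by
  have h := (le_ord_iff hgood (hfin := hfin) (M := M) hI (n := ord hfin M I + 1)).not.1 (by omega)
  obtain ⟨C, hC, hCI, h'⟩ := hgen.exists_of_not_le hI h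
  refine ⟨C, hC, hCI, le_antisymm ?_ (ord_anti hgood hC.reg hCI)⟩
  have := mt (le_ord_iff hgood hC.reg).1 h'
  omega

/-- Regular finitely generated `r`-ideals are invertible. -/
theorem FG.inv (hfin : r.Finitary) (hgood : PrimesGood r) (hgen : GenByInv r) {C : r.RIdeal}
    (hC : C.FG) (hreg : C.Reg) : C.Inv := by
  obtain ⟨y, hyC, hy⟩ := id hreg
  refine ⟨colon (prin r y) C, y, hy, le_antisymm (mul_comm C _ ▸ colon_mul_le _ _) ?_⟩
  have hB : y ∈ colon (prin r y) C := mem_colon.2 fun c _ => mul_mem_right c (mem_prin y)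
  refine le_of_forall_loc hfin (hreg.mul ⟨y, hB, hy⟩) fun M => ?_
  -- Equal orders make `C` locally equal to an invertible `D ≤ C`. The cofactor of `t y` in `D`,
  -- multiplied by `t`, lies in the colon ideal.
  obtain ⟨D, hD, hDC, hDo⟩ := exists_inv_ord_eq (hfin := hfin) hgood hgen M hreg
  obtain ⟨t, ht, htC⟩ := hC.exists_of_le_loc (le_loc_of_ord_le hgood hreg hD.reg hDo.le)
  obtain ⟨B, hB⟩ := hD.dvd ((mul_mono le_rfl (prin_le.2 hyC)).trans htC)
  refine le_loc_of_mul ht (le_loc_of_mul ht (le_trans ?_ le_loc))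
  have h1 : prin r t * B ≤ colon (prin r y) C := by
    rw [le_colon]
    calc prin r t * B * C = prin r t * C * B := by ring
      _ ≤ D * B := mul_mono htC le_rfl
      _ = prin r t * prin r y := hB.symm
      _ ≤ prin r y := mul_le_right _ _
  calc prin r t * (prin r t * prin r y) = D * (prin r t * B) := by rw [hB]; ring
    _ ≤ C * colon (prin r y) C := mul_mono hDC h1

/-- For a product, combine the cores `K` and `L` into `K L / (K + L)`, whose order is the maximum of
theirs. The quotient exists because `K + L` is invertible. -/
theorem exists_rad_core (hgood : PrimesGood r) (hgen : GenByInv r) {A : r.RIdeal}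
    (hA : A ∈ Submonoid.closure {J : r.RIdeal | J.Rad ∧ J.Inv}) :
    A.Inv ∧ ∃ K : r.RIdeal, K.Inv ∧ ∀ M : r.RegMax, ord hfin M K = min (ord hfin M A) 1 := by
  induction hA using Submonoid.closure_induction with
  | mem J hJ => exact ⟨hJ.2, J, hJ.2, fun M => (min_eq_left (hJ.1.ord_le_one hgood hJ.2.reg)).symm⟩
  | one => exact ⟨inv_one, 1, inv_one, fun M => by simp [ord_one hgood]⟩
  | mul A B _ _ hA hB =>
    obtain ⟨hA, K, hK, hKA⟩ := hA
    obtain ⟨hB, L, hL, hLB⟩ := hB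
    refine ⟨hA.mul hB, ?_⟩
    have hKL : (K + L).Inv := FG.inv hfin hgood hgen ((hK.fg hfin).add (hL.fg hfin))
      (hK.reg.mono (le_add_left' _ _))
    obtain ⟨C, hC⟩ := hKL.dvd ((mul_le_left K L).trans (le_add_left' K L))
    have hCi : C.Inv := Inv.of_mul_right (hC ▸ hK.mul hL)
    refine ⟨C, hCi, fun M => ?_⟩
    have h1 := congrArg (ord hfin M) hC
    rw [ord_mul hgood hK.reg hL.reg, ord_mul hgood hKL.reg hCi.reg, ord_add hgood hK.reg hL.reg,
      hKA, hLB] at h1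
    rw [ord_mul hgood hA.reg hB.reg]
    omega

theorem ord_rad (hgood : PrimesGood r) {M : r.RegMax} {I : r.RIdeal} (hI : I.Reg) :
    ord hfin M (rad hfin I) = min (ord hfin M I) 1 := by
  have hR : (rad hfin I).Reg := hI.mono (le_rad hfin I)
  have h1 := (rad_rad hfin I).ord_le_one (hfin := hfin) hgood (M := M) hR
  have h2 := one_le_ord_iff (hfin := hfin) hgood (M := M) hI
  have h3 := one_le_ord_iff (hfin := hfin) hgood (M := M) hR
  have h4 : I ≤ M.ideal ↔ rad hfin I ≤ M.ideal :=
    ⟨fun h => (M.prim hfin).rad.rad_le h, fun h => (le_rad hfin I).trans h⟩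
  rw [h4, ← h3] at h2
  omega

theorem exists_prod_rad_le (hgood : PrimesGood r) (hfin : r.Finitary) {I : r.RIdeal} (hI : I.Reg) :
    ∃ A ∈ Submonoid.closure {J : r.RIdeal | J.Rad ∧ J.Inv}, A ≤ I :=
  exists_prod_le hfin (fun _ hA => hA.2.fg hfin) fun P hP hIP => by
    obtain ⟨-, J, hJP, h1, h2⟩ := hgood P hP (hI.mono hIP)
    exact ⟨J, ⟨h1, h2⟩, hJP⟩

/-- The radical of a regular finitely generated `r`-ideal is finitely generated. -/
theorem FG.rad (hgood : PrimesGood r) (hgen : GenByInv r) {I : r.RIdeal} (hI : I.FG)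
    (hreg : I.Reg) :
    (rad hfin I).FG := by
  obtain ⟨A, hA, hAI⟩ := exists_prod_rad_le hgood hfin hreg
  obtain ⟨hAi, K, hK, hKA⟩ := exists_rad_core (hfin := hfin) hgood hgen hA
  -- Since `A ≤ I`, the order of `A` is at least that of `I`, so `min (ord I) (min (ord A) 1)` is
  -- `min (ord I) 1`.
  have h : RIdeal.rad hfin I = I + K := by
    have h1 : (I + K).Reg := hreg.mono (le_add_left' _ _)
    have h2 : (RIdeal.rad hfin I).Reg := hreg.mono (le_rad hfin I)
    have h3 : ∀ M, ord hfin M (RIdeal.rad hfin I) = ord hfin M (I + K) := fun M => by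
      have := ord_anti (hfin := hfin) hgood (M := M) hAi.reg hAI
      rw [ord_rad hgood hreg, ord_add hgood hreg hK.reg, hKA]
      omega
    exact le_antisymm ((le_iff_ord hgood h2 h1).2 fun M => (h3 M).ge)
      ((le_iff_ord hgood h1 h2).2 fun M => (h3 M).le)
  rw [h]
  exact hI.add (hK.fg hfin)

end ord

end RIdeal

end WeakIdealSystem

/-! ### The inverse topology and continuity of the order -/

namespace WeakIdealSystem

variable {H : Type*} [CommMonoid H] {r : WeakIdealSystem H}

namespace RegLattice

/-- The `r`-ideal underlying an element of the lattice. -/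
def toRIdeal (I : r.RegLattice) : r.RIdeal := ⟨I.1, I.isIdeal⟩

theorem toRIdeal_le {I J : r.RegLattice} : I.toRIdeal ≤ J.toRIdeal ↔ I ≤ J := Iff.rfl

theorem toRIdeal_of_not_reg {I : r.RegLattice} (h : ¬ I.toRIdeal.Reg) : I.toRIdeal = 0 := by
  rcases I.2 with h1 | h1
  · exact absurd h1.2 h
  · exact Subtype.ext h1

/-- A regular `r`-ideal as an element of the lattice. -/
def mk (I : r.RIdeal) (hI : I.Reg) : r.RegLattice := ⟨I.1, Or.inl ⟨I.2, hI⟩⟩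

theorem isCompactElement_of_fg (hfin : r.Finitary) {D : r.RegLattice} (hD : D.toRIdeal.FG) :
    IsCompactElement D := by
  rw [CompleteLattice.isCompactElement_iff_le_of_directed_sSup_le]
  intro S hS hdir hle
  obtain ⟨E, hE, hDE⟩ := hD
  have h1 : E ⊆ r.cl (⋃ I ∈ S, I.1) := fun x hx => hle (hDE.ge (RIdeal.subset_span E hx))
  have h2 : ∃ I ∈ S, E ⊆ I.toRIdeal := by
    clear hDE
    induction E, hE using Set.Finite.induction_on with
    | empty => exact ⟨_, hS.some_mem, Set.empty_subset _⟩
    | @insert a t _ _ ih =>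
      obtain ⟨I, hI, htI⟩ := ih ((Set.subset_insert _ _).trans h1)
      obtain ⟨F, hFS, hF, haF⟩ := RIdeal.mem_span_finite hfin (h1 (Set.mem_insert a t))
      have h3 : ∃ J ∈ S, F ⊆ J.toRIdeal := by
        clear haF
        induction F, hF using Set.Finite.induction_on with
        | empty => exact ⟨_, hS.some_mem, Set.empty_subset _⟩
        | @insert b u _ _ ih' =>
          obtain ⟨J, hJ, huJ⟩ := ih' ((Set.subset_insert _ _).trans hFS)
          obtain ⟨K, hK, hbK⟩ := Set.mem_iUnion₂.1 (hFS (Set.mem_insert b u))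
          obtain ⟨L, hL, hJL, hKL⟩ := hdir J hJ K hK
          exact ⟨L, hL, Set.insert_subset (hKL hbK) (huJ.trans hJL)⟩
      obtain ⟨J, hJ, hFJ⟩ := h3
      obtain ⟨L, hL, hIL, hJL⟩ := hdir I hI J hJ
      exact ⟨L, hL, Set.insert_subset (hJL (RIdeal.span_le.2 hFJ haF)) (htI.trans hIL)⟩
  obtain ⟨I, hI, hEI⟩ := h2
  refine ⟨I, hI, ?_⟩
  rw [← toRIdeal_le, hDE]
  exact RIdeal.span_le.2 hEI

/-- A regular `C` is the directed join of its finitely generated subideals containing a fixed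
regular `y`; requiring `y` keeps these inside the lattice. -/
theorem fg_of_isCompactElement {C : r.RegLattice} (hC : IsCompactElement C) : C.toRIdeal.FG := by
  by_cases hreg : C.toRIdeal.Reg
  · obtain ⟨y, hyC, hy⟩ := hreg
    obtain ⟨D, ⟨hD, hDC, -⟩, hCD⟩ := hC {D | D.toRIdeal.FG ∧ D ≤ C ∧ y ∈ D.toRIdeal} C
      ⟨mk (RIdeal.prin r y) (RIdeal.inv_prin hy).reg, RIdeal.fg_prin y, RIdeal.prin_le.2 hyC,
        RIdeal.mem_prin y⟩
      (by
        rintro D ⟨hD, hDC, hyD⟩ K ⟨hK, hKC, hyK⟩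
        have hmem := RIdeal.le_add_left' D.toRIdeal K.toRIdeal hyD
        exact ⟨mk (D.toRIdeal + K.toRIdeal) ⟨y, hmem, hy⟩,
          ⟨hD.add hK, (RIdeal.add_le.2 ⟨hDC, hKC⟩ : D.toRIdeal + K.toRIdeal ≤ C.toRIdeal), hmem⟩,
            RIdeal.le_add_left' D.toRIdeal K.toRIdeal,
          RIdeal.le_add_right' D.toRIdeal K.toRIdeal⟩)
      ⟨fun D hD => hD.2.1, fun U hU x hx => by
        have h1 : y ∈ RIdeal.span r {x, y} := RIdeal.subset_span _ (by simp)
        have h2 : mk (RIdeal.span r {x, y}) ⟨y, h1, hy⟩ ≤ U := hU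
          ⟨⟨{x, y}, by simp, rfl⟩, RIdeal.span_le.2 (Set.insert_subset hx
            (Set.singleton_subset_iff.2 hyC)), h1⟩
        exact h2 (RIdeal.subset_span _ (by simp : x ∈ ({x, y} : Set H)))⟩ le_rfl
    rwa [le_antisymm hCD hDC]
  · rw [toRIdeal_of_not_reg hreg]
    exact ⟨∅, Set.finite_empty, rfl⟩

end RegLattice

namespace RIdeal

theorem not_reg_zero (hne : r.cl ∅ ≠ Set.univ) : ¬ (0 : r.RIdeal).Reg := by
  rintro ⟨x, hx, hxr⟩
  have h : prin r x * 1 ≤ prin r x * 0 := by rw [mul_one, mul_zero]; exact prin_le.2 hx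
  have h1 : ((0 : r.RIdeal) : Set H) ≠ Set.univ := hne
  exact ne_one_iff.1 h1 (one_le_iff.1 ((inv_prin hxr).cancel_le h))

theorem isOpen_setOf_le (hfin : r.Finitary) {D : r.RIdeal} (hD : D.FG) (hreg : D.Reg) :
    IsOpen {M : r.RegMax | D ≤ M.ideal} :=
  TopologicalSpace.isOpen_generateFrom_of_mem
    ⟨RegLattice.mk D hreg, RegLattice.isCompactElement_of_fg hfin hD, rfl⟩

/-- A compact element may be the bottom, which is not regular; adjoining a regular element of `M`
only shrinks the neighbourhood. -/
theorem exists_fg_of_mem_isOpen {O : Set r.RegMax} (hO : IsOpen O) {M : r.RegMax} (hM : M ∈ O) :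
    ∃ D : r.RIdeal, D.FG ∧ D.Reg ∧ D ≤ M.ideal ∧ ∀ N : r.RegMax, D ≤ N.ideal → N ∈ O := by
  induction hO with
  | basic s hs =>
    obtain ⟨C, hC, rfl⟩ := hs
    obtain ⟨E, hE, hCE⟩ := RegLattice.fg_of_isCompactElement hC
    have hEM : E ⊆ M.ideal := (subset_span E).trans (hCE.ge.trans hM)
    obtain ⟨D, h1, h2, h3, h4⟩ := M.reg.exists_fg hE hEM
    refine ⟨D, h1, h2, h4, fun N hN => ?_⟩
    have h5 : C.toRIdeal ≤ N.ideal := hCE ▸ span_le.2 (h3.trans hN)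
    exact h5
  | univ =>
    obtain ⟨D, h1, h2, -, h4⟩ := M.reg.exists_fg Set.finite_empty (Set.empty_subset _)
    exact ⟨D, h1, h2, h4, fun _ _ => trivial⟩
  | inter s t _ _ ihs iht =>
    obtain ⟨D, h1, h2, h3, h4⟩ := ihs hM.1
    obtain ⟨D', h1', -, h3', h4'⟩ := iht hM.2
    exact ⟨D + D', h1.add h1', h2.mono (le_add_left' _ _), add_le.2 ⟨h3, h3'⟩, fun N hN =>
      ⟨h4 N ((le_add_left' _ _).trans hN), h4' N ((le_add_right' _ _).trans hN)⟩⟩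
  | sUnion S _ ih =>
    obtain ⟨s, hs, hMs⟩ := hM
    obtain ⟨D, h1, h2, h3, h4⟩ := ih s hs hMs
    exact ⟨D, h1, h2, h3, fun N hN => ⟨s, hs, h4 N hN⟩⟩

/-- Two comaximal `r`-ideals are comaximal already after shrinking the second one to a regular
finitely generated `r`-ideal. -/
theorem exists_fg_one_mem_add (hfin : r.Finitary) {F M : r.RIdeal} (hM : M.Reg)
    (h : (1 : H) ∈ F + M) :
    ∃ D : r.RIdeal, D.FG ∧ D.Reg ∧ D ≤ M ∧ (1 : H) ∈ F + D := by
  obtain ⟨E, hE, hEf, h1⟩ := mem_span_finite hfin h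
  obtain ⟨D, hD, hDr, hED,
    hDM⟩ := hM.exists_fg (hEf.inter_of_left (M : Set H)) Set.inter_subset_right
  refine ⟨D, hD, hDr, hDM, (span_le.2 fun x hx => ?_ : span r E ≤ F + D) h1⟩
  rcases hE hx with hF | hxM
  · exact le_add_left' F D hF
  · exact le_add_right' F D (hED ⟨hx, hxM⟩)

section

variable {hfin : r.Finitary}

/-- Take an invertible `C ≤ I` of the same order `m` at `M` and write `C = (C + J ^ m) F`. Then `F`
has order zero at `M`, and also wherever a suitable `D ≤ M` comaximal with `F` is contained. There
`ord C ≤ m * ord J ≤ m`, and `ord I ≤ ord C`. -/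
theorem upperSemicontinuous_ord (hgood : PrimesGood r) (hgen : GenByInv r) {I : r.RIdeal}
    (hI : I.Reg) :
    UpperSemicontinuous fun M : r.RegMax => ord hfin M I := by
  intro M k hk
  obtain ⟨C, hC, hCI, hCo⟩ := exists_inv_ord_eq (hfin := hfin) hgood hgen M hI
  obtain ⟨-, J, hJM, hJrad, hJ⟩ := hgood M.ideal (M.prim hfin) M.reg
  set m := ord hfin M I with hm
  have hJm := hJ.pow m
  have hG : (C + J ^ m).Inv := FG.inv hfin hgood hgen ((hC.fg hfin).add (hJm.fg hfin))
    (hC.reg.mono (le_add_left' _ _))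
  obtain ⟨F, hF⟩ := hG.dvd (le_add_left' C (J ^ m))
  have hFr : F.Reg := hC.reg.mono (hF.le.trans (mul_le_right _ _))
  have hGo : ∀ N : r.RegMax, ord hfin N (C + J ^ m) = min (ord hfin N C) (m * ord hfin N J) :=
    fun N => by rw [ord_add hgood hC.reg hJm.reg, ord_pow hgood hJ.reg]
  have hFo : ∀ N : r.RegMax, ord hfin N C = min (ord hfin N C) (m * ord hfin N J) + ord hfin N F :=
    fun N => by rw [← hGo N, ← ord_mul hgood hG.reg hFr, ← hF]
  have hFM : ¬ F ≤ M.ideal := by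
    rw [← one_le_ord_iff (hfin := hfin) hgood hFr]
    have h1 := hFo M
    have h2 := Nat.le_mul_of_pos_right m ((one_le_ord_iff (hfin := hfin) hgood hJ.reg).2 hJM)
    omega
  obtain ⟨D, hD, hDr, hDM, hDF⟩ := exists_fg_one_mem_add hfin M.reg (M.maxi.one_mem_add hFM)
  refine Filter.mem_of_superset ((isOpen_setOf_le hfin hD hDr).mem_nhds hDM) fun N hN => ?_
  have hFN : ¬ F ≤ N.ideal := fun hc => (N.prim hfin).1 (add_le.2 ⟨hc, hN⟩ hDF)
  rw [← one_le_ord_iff (hfin := hfin) hgood hFr] at hFN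
  have h1 := hFo N
  have h2 := Nat.mul_le_mul_left m (hJrad.ord_le_one (hfin := hfin) hgood (M := N) hJ.reg)
  have h3 := ord_anti (hfin := hfin) hgood (M := N) hC.reg hCI
  change ord hfin N I < k
  change m < k at hk
  omega

/-- Every prime above `I` is a point of the space, so it contains some `D` whose neighbourhood lies
in one member of the cover. Then `I` contains a finite product of such `D`, whose factors select a
finite subcover. -/
theorem isCompact_setOf_le (hfin : r.Finitary) (hgood : PrimesGood r) {I : r.RIdeal} (hI : I.Reg) :
    IsCompact {M : r.RegMax | I ≤ M.ideal} := by
  refine isCompact_of_finite_subcover fun {ι} U hU hcov => ?_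
  obtain ⟨A, hA, hAI⟩ := exists_prod_le hfin
    (S := {D : r.RIdeal | D.FG ∧ ∃ i, ∀ M : r.RegMax, D ≤ M.ideal → M ∈ U i}) (fun _ h => h.1)
    (I := I) (fun P hP hIP => by
      let M : r.RegMax := ⟨P, (hgood P hP (hI.mono hIP)).1, hI.mono hIP⟩
      obtain ⟨i, hi⟩ := Set.mem_iUnion.1 (hcov (show M ∈ {M : r.RegMax | I ≤ M.ideal} from hIP))
      obtain ⟨D, hD, -, hDM, h⟩ := exists_fg_of_mem_isOpen (hU i) hi
      exact ⟨D, ⟨hD, i, h⟩, hDM⟩)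
  have key : ∃ t : Finset ι, ∀ M : r.RegMax, A ≤ M.ideal → M ∈ ⋃ i ∈ t, U i := by
    classical
    clear hAI
    induction hA using Submonoid.closure_induction with
    | mem D hD =>
      obtain ⟨-, i, hi⟩ := hD
      exact ⟨{i}, fun M hM => by simpa using hi M hM⟩
    | one => exact ⟨∅, fun M hM => absurd (one_le_iff.1 hM) (M.prim hfin).1⟩
    | mul A B _ _ hA hB =>
      obtain ⟨s, hs⟩ := hA
      obtain ⟨t, ht⟩ := hB
      refine ⟨s ∪ t, fun M hM => ?_⟩
      rw [Finset.set_biUnion_union]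
      exact ((M.prim hfin).le_or_le hM).imp (hs M) (ht M)
  obtain ⟨t, ht⟩ := key
  exact ⟨t, fun M hM => ht M (hAI.trans hM)⟩

theorem hasCompactSupport_ord (hgood : PrimesGood r) (hgen : GenByInv r) {I : r.RIdeal}
    (hI : I.Reg) :
    HasCompactSupport fun M : r.RegMax => ord hfin M I := by
  have h : Function.support (fun M : r.RegMax => ord hfin M I) = {M | I ≤ M.ideal} := by
    ext M
    rw [Function.mem_support, Set.mem_ofPred_eq, ← one_le_ord_iff (hfin := hfin) hgood hI]
    omega
  have hcl : IsClosed {M : r.RegMax | I ≤ M.ideal} := by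
    rw [← h]
    convert (upperSemicontinuous_ord (hfin := hfin) hgood hgen hI).isClosed_preimage 1 using 1
    ext M
    simp [Nat.one_le_iff_ne_zero]
  rw [HasCompactSupport, tsupport, h, hcl.closure_eq]
  exact isCompact_setOf_le hfin hgood hI

/-- The function `M ↦ ord M I` as an element of `U(X)`. -/
noncomputable def ordFun (hfin : r.Finitary) (hgood : PrimesGood r) (hgen : GenByInv r)
    {I : r.RIdeal} (hI : I.Reg) :
    USCFun r.RegMax :=
  ⟨fun M => ord hfin M I, upperSemicontinuous_ord hgood hgen hI,
    hasCompactSupport_ord hgood hgen hI⟩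

/-- The intersection of a set of regular `r`-maximal `r`-ideals. -/
def interMax (Z : Set r.RegMax) : r.RIdeal := ⟨{x | ∀ M ∈ Z, x ∈ M.ideal}, by
  refine Set.Subset.antisymm (fun x hx M hM => ?_) (r.subset_cl _)
  exact (span_le.2 (fun y hy => hy M hM) : span r {x | ∀ M ∈ Z, x ∈ M.ideal} ≤ M.ideal) hx⟩

theorem le_interMax {Z : Set r.RegMax} {I : r.RIdeal} : I ≤ interMax Z ↔ ∀ M ∈ Z, I ≤ M.ideal :=
  ⟨fun h M hM _ hx => h hx M hM, fun h _ hx M hM => h M hM hx⟩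

theorem interMax_rad (hfin : r.Finitary) (Z : Set r.RegMax) : (interMax Z).Rad :=
    fun _ _ _ h M hM =>
  (M.prim hfin).mem_of_pow (h M hM)

theorem reg_interMax {Z : Set r.RegMax} (hgood : PrimesGood r) (hfin : r.Finitary)
    (hZ : IsCompact Z) : (interMax Z).Reg := by
  obtain ⟨A, hA, h⟩ : ∃ A : r.RIdeal, A.Reg ∧ ∀ M ∈ Z, A ≤ M.ideal := by
    refine hZ.induction_on (p := fun Z => ∃ A : r.RIdeal, A.Reg ∧ ∀ M ∈ Z, A ≤ M.ideal)
      ⟨1, reg_one, by simp⟩ (fun s t hst ⟨A, hA, h⟩ => ⟨A, hA, fun M hM => h M (hst hM)⟩) ?_ ?_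
    · rintro s t ⟨A, hA, h⟩ ⟨B, hB, h'⟩
      refine ⟨A * B, hA.mul hB, ?_⟩
      rintro M (hM | hM)
      · exact (mul_le_left _ _).trans (h M hM)
      · exact (mul_le_right _ _).trans (h' M hM)
    · intro M _
      obtain ⟨-, J, hJM, -, hJ⟩ := hgood M.ideal (M.prim hfin) M.reg
      exact ⟨_, mem_nhdsWithin_of_mem_nhds ((isOpen_setOf_le hfin (hJ.fg hfin) hJ.reg).mem_nhds hJM),
        J, hJ.reg, fun N hN => hN⟩
  exact hA.mono (le_interMax.2 h)

/-- For `N ∉ Z`, closedness gives `C ≤ N` contained in no point of `Z`. By compactness, finitely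
many ideals comaximal with `C` multiply to one that lies in all points of `Z` and is still comaximal
with `C`, so `N` cannot contain the intersection. -/
theorem interMax_le_iff (hfin : r.Finitary) {Z : Set r.RegMax} (hZ : IsCompact Z)
    (hZc : IsClosed Z) {N : r.RegMax} :
    interMax Z ≤ N.ideal ↔ N ∈ Z := by
  refine ⟨fun h => ?_, fun h => le_interMax.1 le_rfl N h⟩
  by_contra hN
  obtain ⟨C, hC, hCr, hCN, hCZ⟩ := exists_fg_of_mem_isOpen hZc.isOpen_compl hN
  obtain ⟨A, hA, h'⟩ : ∃ A : r.RIdeal, (1 : H) ∈ C + A ∧ ∀ M ∈ Z, A ≤ M.ideal := by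
    refine hZ.induction_on (p := fun Z => ∃ A : r.RIdeal, (1 : H) ∈ C + A ∧ ∀ M ∈ Z, A ≤ M.ideal)
      ⟨1, le_add_right' C 1 (mem_one 1), by simp⟩
      (fun s t hst ⟨A, hA, h⟩ => ⟨A, hA, fun M hM => h M (hst hM)⟩) ?_ ?_
    · rintro s t ⟨A, hA, h⟩ ⟨B, hB, h'⟩
      refine ⟨A * B, ?_, ?_⟩
      · have h1 := mul_mem_mul hA hB
        have e : (C + A) * (C + B) = C * (C + A + B) + A * B := by ring
        rw [mul_one, e] at h1
        exact add_le.2 ⟨(mul_le_left _ _).trans (le_add_left' _ _), le_add_right' _ _⟩ h1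
      · rintro M (hM | hM)
        · exact (mul_le_left _ _).trans (h M hM)
        · exact (mul_le_right _ _).trans (h' M hM)
    · intro M hM
      have hCM : ¬ C ≤ M.ideal := fun hc => hCZ M hc hM
      obtain ⟨D, hD, hDr, hDM, h1⟩ := exists_fg_one_mem_add hfin M.reg (M.maxi.one_mem_add hCM)
      exact ⟨_, mem_nhdsWithin_of_mem_nhds ((isOpen_setOf_le hfin hD hDr).mem_nhds hDM),
        D, h1, fun N hN => hN⟩
  exact (N.prim hfin).1 (add_le.2 ⟨hCN, (le_interMax.2 h').trans h⟩ hA)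

end

end RIdeal

end WeakIdealSystem

/-! ### Decomposing upper semicontinuous functions -/

namespace USCFun

variable {X : Type*} [TopologicalSpace X]

/-- Composition with a monotone function fixing `0`. -/
def comp (g : ℕ → ℕ) (hg : Monotone g) (h0 : g 0 = 0) (f : USCFun X) : USCFun X :=
  ⟨g ∘ f.1, fun x k hk => by
    -- For integer values, semicontinuity means `f y ≤ f x` for all `y` near `x`.
    filter_upwards [f.2.1 x (f.1 x + 1) (Nat.lt_succ_self _)] with y hy
    exact (hg (Nat.lt_succ_iff.1 hy)).trans_lt hk, f.2.2.comp_left h0⟩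

/-- The indicator function of the support. -/
def ind (f : USCFun X) : USCFun X :=
  comp (fun n => min n 1) (fun _ _ h => min_le_min_right 1 h) rfl f

/-- The truncated difference of `f` and `1`. -/
def pred (f : USCFun X) : USCFun X :=
  comp (fun n => n - 1) (fun _ _ h => Nat.sub_le_sub_right h 1) rfl f

theorem ind_apply (f : USCFun X) (x : X) : f.ind.1 x = min (f.1 x) 1 := rfl
theorem pred_apply (f : USCFun X) (x : X) : f.pred.1 x = f.1 x - 1 := rfl
theorem add_apply (f g : USCFun X) (x : X) : (f + g).1 x = f.1 x + g.1 x := rfl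
theorem zero_apply (x : X) : (0 : USCFun X).1 x = 0 := rfl

theorem ext' {f g : USCFun X} (h : ∀ x, f.1 x = g.1 x) : f = g := Subtype.ext (funext h)

theorem ind_add_pred (f : USCFun X) : f.ind + f.pred = f := ext' fun x => by
  rw [add_apply, ind_apply, pred_apply]; omega

theorem exists_bound (f : USCFun X) : ∃ n, ∀ x, f.1 x ≤ n := by
  obtain ⟨n, hn⟩ : ∃ n, ∀ x ∈ tsupport f.1, f.1 x ≤ n := by
    refine f.2.2.isCompact.induction_on (p := fun s => ∃ n, ∀ x ∈ s, f.1 x ≤ n) ⟨0, by simp⟩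
      (fun s t hst ⟨n, hn⟩ => ⟨n, fun x hx => hn x (hst hx)⟩) ?_ fun x _ => ?_
    · rintro s t ⟨m, hm⟩ ⟨n, hn⟩
      exact ⟨max m n, fun x hx => hx.elim (fun h => (hm x h).trans (le_max_left _ _))
        fun h => (hn x h).trans (le_max_right _ _)⟩
    · exact ⟨_, mem_nhdsWithin_of_mem_nhds (f.2.1 x (f.1 x + 1) (Nat.lt_succ_self _)), f.1 x,
        fun y hy => Nat.lt_succ_iff.1 hy⟩
  refine ⟨n, fun x => ?_⟩
  by_cases hx : x ∈ tsupport f.1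
  · exact hn x hx
  · rw [image_eq_zero_of_notMem_tsupport hx]; exact Nat.zero_le n

/-- Induction by splitting off the indicator function of the support. -/
theorem induction_ind {p : USCFun X → Prop} (h0 : p 0) (h : ∀ f : USCFun X, f ≠ 0 → p f.pred → p f)
    (f : USCFun X) : p f := by
  obtain ⟨n, hn⟩ := f.exists_bound
  induction n generalizing f with
  | zero =>
    have : f = 0 := ext' fun x => Nat.le_zero.1 (hn x)
    rwa [this]
  | succ n ih =>
    by_cases hf : f = 0
    · rwa [hf]
    · exact h f hf (ih _ fun x => by rw [pred_apply]; have := hn x; omega)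

end USCFun

/-! ### The isomorphism with `U_b` -/

namespace WeakIdealSystem

namespace RIdeal

variable {H : Type*} [CommMonoid H] {r : WeakIdealSystem H}

theorem exists_ord_eq_ind (hfin : r.Finitary) (hgood : PrimesGood r) (f : USCFun r.RegMax) :
    ∃ I : r.RIdeal, I.Reg ∧ ∀ M, ord hfin M I = f.ind.1 M := by
  have hcl : IsClosed {M | 1 ≤ f.1 M} := f.2.1.isClosed_preimage 1
  have hc : IsCompact {M | 1 ≤ f.1 M} := by
    refine f.2.2.isCompact.of_isClosed_subset hcl fun M hM => subset_tsupport _ ?_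
    rw [Function.mem_support]
    exact Nat.one_le_iff_ne_zero.1 hM
  have hreg := reg_interMax hgood hfin hc
  refine ⟨_, hreg, fun M => ?_⟩
  have h1 := (interMax_rad hfin _).ord_le_one (hfin := hfin) hgood (M := M) hreg
  have h2 := (one_le_ord_iff (hfin := hfin) hgood (M := M) hreg).trans (interMax_le_iff hfin hc hcl)
  rw [Set.mem_ofPred_eq] at h2
  rw [USCFun.ind_apply]
  omega

theorem exists_ord_eq (hfin : r.Finitary) (hgood : PrimesGood r) (f : USCFun r.RegMax) :
    ∃ I : r.RIdeal, I.Reg ∧ ∀ M, ord hfin M I = f.1 M := by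
  induction f using USCFun.induction_ind with
  | h0 => exact ⟨1, reg_one, fun M => ord_one hgood⟩
  | h f _ ih =>
    obtain ⟨I, hI, h⟩ := ih
    obtain ⟨J, hJ, h'⟩ := exists_ord_eq_ind hfin hgood f
    refine ⟨J * I, hJ.mul hI, fun M => ?_⟩
    rw [ord_mul hgood hJ hI, h, h', ← USCFun.add_apply, USCFun.ind_add_pred]

open Classical in
/-- The map `I ↦ (M ↦ ord M I)` from `𝓘_r(H)_reg` to `U_b(X)`. -/
noncomputable def toUb (hfin : r.Finitary) (hgood : PrimesGood r) (hgen : GenByInv r)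
    (I : r.RegLattice) :
    UbLattice r.RegMax :=
  if h : I.toRIdeal.Reg then (ordFun hfin hgood hgen h : USCFun r.RegMax) else ⊥

section

variable (hfin : r.Finitary) (hgood : PrimesGood r) (hgen : GenByInv r)

theorem toUb_of_reg {I : r.RegLattice} (h : I.toRIdeal.Reg) :
    toUb hfin hgood hgen I = (ordFun hfin hgood hgen h : USCFun r.RegMax) := dif_pos h

theorem toUb_of_not_reg {I : r.RegLattice} (h : ¬ I.toRIdeal.Reg) : toUb hfin hgood hgen I = ⊥ :=
  dif_neg h

theorem toUb_le_iff {I J : r.RegLattice} :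
    toUb hfin hgood hgen I ≤ toUb hfin hgood hgen J ↔ I ≤ J := by
  by_cases hI : I.toRIdeal.Reg
  · rw [toUb_of_reg _ _ _ hI]
    by_cases hJ : J.toRIdeal.Reg
    · rw [toUb_of_reg _ _ _ hJ, WithBot.coe_le_coe, ← RegLattice.toRIdeal_le,
        le_iff_ord (hfin := hfin) hgood hI hJ]
      rfl
    · rw [toUb_of_not_reg _ _ _ hJ]
      refine ⟨fun h => absurd h (WithBot.not_coe_le_bot _), fun h => absurd (hI.mono h) hJ⟩
  · rw [toUb_of_not_reg _ _ _ hI]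
    refine ⟨fun _ => ?_, fun _ => bot_le⟩
    rw [← RegLattice.toRIdeal_le, RegLattice.toRIdeal_of_not_reg hI]
    exact bot_le (α := r.RIdeal)

theorem toUb_mul (I J : r.RegLattice) :
    toUb hfin hgood hgen (I * J) = toUb hfin hgood hgen I + toUb hfin hgood hgen J := by
  by_cases hI : I.toRIdeal.Reg
  · by_cases hJ : J.toRIdeal.Reg
    · rw [toUb_of_reg _ _ _ hI, toUb_of_reg _ _ _ hJ, toUb_of_reg _ _ _ (I := I * J) (hI.mul hJ),
      ← WithBot.coe_add]
      congr 1
      exact USCFun.ext' fun M => ord_mul hgood hI hJ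
    · have h : ¬ (I * J).toRIdeal.Reg := fun hc => hJ (hc.mono (mul_le_right I.toRIdeal J.toRIdeal))
      rw [toUb_of_not_reg _ _ _ hJ, toUb_of_not_reg _ _ _ h, WithBot.add_bot]
  · have h : ¬ (I * J).toRIdeal.Reg := fun hc => hI (hc.mono (mul_le_left I.toRIdeal J.toRIdeal))
    rw [toUb_of_not_reg _ _ _ hI, toUb_of_not_reg _ _ _ h, WithBot.bot_add]

theorem toUb_surjective (hne : r.cl ∅ ≠ Set.univ) : Function.Surjective (toUb hfin hgood hgen) := by
  intro f
  induction f using WithBot.recBotCoe with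
  | bot => exact ⟨⟨r.cl ∅, Or.inr rfl⟩, toUb_of_not_reg _ _ _ (not_reg_zero hne)⟩
  | coe f =>
    obtain ⟨I, hI, h⟩ := exists_ord_eq hfin hgood f
    refine ⟨RegLattice.mk I hI, ?_⟩
    rw [toUb_of_reg _ _ _ (I := RegLattice.mk I hI) hI]
    congr 1
    exact USCFun.ext' h

theorem exists_orderIso (hfin : r.Finitary) (hgood : PrimesGood r) (hgen : GenByInv r)
    (hne : r.cl ∅ ≠ Set.univ) :
    ∃ e : r.RegLattice ≃o UbLattice r.RegMax, ∀ I J : r.RegLattice, e (I * J) = e I + e J :=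
  ⟨RelIso.ofSurjective (OrderEmbedding.ofMapLEIff (toUb hfin hgood hgen)
    fun _ _ => toUb_le_iff hfin hgood hgen) (toUb_surjective hfin hgood hgen hne),
    toUb_mul hfin hgood hgen⟩

end

end RIdeal

end WeakIdealSystem

/-! ### Chain factorizations from an abstract isomorphism -/

namespace WeakIdealSystem

variable {H : Type*} [CommMonoid H] {r : WeakIdealSystem H}

namespace RIdeal

theorem add_pow_le (I J : r.RIdeal) (n : ℕ) : (I + J) ^ n ≤ I + J ^ n := by
  induction n with
  | zero => rw [pow_zero, pow_zero]; exact le_add_right' _ _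
  | succ n ih =>
    rw [pow_succ, pow_succ]
    refine (mul_mono ih le_rfl).trans ?_
    have e : (I + J ^ n) * (I + J) = I * (I + J + J ^ n) + J ^ n * J := by ring
    rw [e]
    exact add_le.2 ⟨(mul_le_left _ _).trans (le_add_left' _ _), le_add_right' _ _⟩

theorem pow_length_le_prod {I : r.RIdeal} {l : List r.RIdeal} (h : ∀ J ∈ l, I ≤ J) :
    I ^ l.length ≤ l.prod := by
  induction l with
  | nil => simp
  | cons a t ih =>
    rw [List.length_cons, List.prod_cons, pow_succ']
    exact mul_mono (h a List.mem_cons_self) (ih fun J hJ => h J (List.mem_cons_of_mem _ hJ))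

/-- A map from `r`-ideals to `U(X)` which, on regular `r`-ideals, is a surjective order embedding
and turns products into sums. -/
structure IsUSCValuation {X : Type*} [TopologicalSpace X] (v : r.RIdeal → USCFun X) : Prop where
  le_iff : ∀ I K : r.RIdeal, I.Reg → K.Reg → (I ≤ K ↔ v I ≤ v K)
  map_mul : ∀ I K : r.RIdeal, I.Reg → K.Reg → v (I * K) = v I + v K
  surj : ∀ f : USCFun X, ∃ I : r.RIdeal, I.Reg ∧ v I = f

/-- An order isomorphism matches bottoms, so exactly the regular ideals have values in `U(X)`. Other
ideals receive the irrelevant value `0`. -/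
theorem exists_isUSCValuation {X : Type*} [TopologicalSpace X] (hne : r.cl ∅ ≠ Set.univ)
    (e : r.RegLattice ≃o UbLattice X) (he : ∀ I J : r.RegLattice, e (I * J) = e I + e J) :
    ∃ v : r.RIdeal → USCFun X, IsUSCValuation v := by
  have hbot : ∀ I : r.RegLattice, e I = ⊥ ↔ ¬ I.toRIdeal.Reg := by
    intro I
    constructor
    · intro h hI
      have h1 : e I ≤ e ⟨r.cl ∅, Or.inr rfl⟩ := h ▸ bot_le
      exact not_reg_zero hne (hI.mono (e.le_iff_le.1 h1))
    · intro hI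
      rw [← le_bot_iff, ← e.le_symm_apply, ← RegLattice.toRIdeal_le,
        RegLattice.toRIdeal_of_not_reg hI]
      exact bot_le (α := r.RIdeal)
  have hex : ∀ I : r.RIdeal, ∃ f : USCFun X, ∀ hI : I.Reg, e (RegLattice.mk I hI) = f := by
    intro I
    by_cases hI : I.Reg
    · obtain ⟨f, hf⟩ := WithBot.ne_bot_iff_exists.1 (mt (hbot (RegLattice.mk I hI)).1 (not_not.2 hI))
      exact ⟨f, fun _ => hf.symm⟩
    · exact ⟨0, fun h => absurd h hI⟩
  choose v hv using hex
  refine ⟨v, fun I K hI hK => ?_, fun I K hI hK => ?_, fun f => ?_⟩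
  · rw [← WithBot.coe_le_coe (a := v I), ← hv I hI, ← hv K hK, e.le_iff_le]
    rfl
  · rw [← WithBot.coe_inj, WithBot.coe_add, ← hv I hI, ← hv K hK, ← he, ← hv _ (hI.mul hK)]
    rfl
  · have h1 : (e.symm f).toRIdeal.Reg := by
      by_contra hc
      rw [← hbot, e.apply_symm_apply] at hc
      exact WithBot.coe_ne_bot hc
    refine ⟨_, h1, WithBot.coe_injective ?_⟩
    rw [← hv _ h1]
    exact e.apply_symm_apply _

section

variable {X : Type*} [TopologicalSpace X] {v : r.RIdeal → USCFun X}

theorem IsUSCValuation.map_one (hv : IsUSCValuation v) : v 1 = 0 := by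
  have h := hv.map_mul 1 1 reg_one reg_one
  rw [mul_one] at h
  refine USCFun.ext' fun x => ?_
  have h1 := congrArg (fun f : USCFun X => f.1 x) h
  rw [USCFun.zero_apply]
  simp only [USCFun.add_apply] at h1
  omega

theorem IsUSCValuation.map_pow (hv : IsUSCValuation v) {I : r.RIdeal} (hI : I.Reg) (n : ℕ) (x : X) :
    (v (I ^ n)).1 x = n * (v I).1 x := by
  induction n with
  | zero => rw [pow_zero, hv.map_one, USCFun.zero_apply, Nat.zero_mul]
  | succ n ih => rw [pow_succ, hv.map_mul _ _ (hI.pow n) hI, USCFun.add_apply, ih, Nat.succ_mul]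

theorem IsUSCValuation.inj (hv : IsUSCValuation v) {I K : r.RIdeal} (hI : I.Reg) (hK : K.Reg)
    (h : v I = v K) : I = K :=
  le_antisymm ((hv.le_iff I K hI hK).2 h.le) ((hv.le_iff K I hK hI).2 h.ge)

theorem IsUSCValuation.cancel (hv : IsUSCValuation v) {I K L : r.RIdeal} (hI : I.Reg) (hK : K.Reg)
    (hL : L.Reg) (h : I * K = I * L) : K = L := by
  refine hv.inj hK hL (USCFun.ext' fun x => ?_)
  have h1 := congrArg (fun J => (v J).1 x) h
  simp only [hv.map_mul _ _ hI hK, hv.map_mul _ _ hI hL, USCFun.add_apply] at h1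
  omega

/-- If `y ^ n ∈ J`, then `(J + (y)) ^ n ≤ J`. So `J + (y)` has positive value wherever `J` has value
`1`, which already gives `J + (y) ≤ J`. -/
theorem IsUSCValuation.rad (hv : IsUSCValuation v) {J : r.RIdeal} (hJ : J.Reg)
    (h : ∀ x, (v J).1 x ≤ 1) : J.Rad := by
  intro n y hn hy
  have hA : (J + prin r y).Reg := hJ.mono (le_add_left' _ _)
  have h1 : (J + prin r y) ^ n ≤ J := (add_pow_le _ _ n).trans
    (add_le.2 ⟨le_rfl, by rw [← prin_pow, prin_le]; exact hy⟩)
  rw [hv.le_iff _ _ (hA.pow n) hJ] at h1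
  have h2 : J + prin r y ≤ J := (hv.le_iff _ _ hA hJ).2 fun x => by
    have h3 := h1 x
    rw [hv.map_pow hA] at h3
    have h4 := h x
    rcases Nat.eq_zero_or_pos ((v (J + prin r y)).1 x) with h5 | h5
    · rw [h5, Nat.mul_zero] at h3
      omega
    · omega
  exact prin_le.1 ((le_add_right' _ _).trans h2)

/-- The first member `a` of a chain is its smallest, so a power of `a` lies in the product and hence
in each radical factor of the other chain. By symmetry the first members agree, and they cancel. -/
theorem eq_of_chain_prod_eq
    (hcancel : ∀ I K L : r.RIdeal, I.Reg → K.Reg → L.Reg → I * K = I * L → K = L)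
    {l l' : List r.RIdeal} (hreg : l.prod.Reg)
    (hl : ∀ J ∈ l, J.Rad ∧ (1 : H) ∉ J) (hl' : ∀ J ∈ l', J.Rad ∧ (1 : H) ∉ J)
    (hc : l.Pairwise (· ≤ ·)) (hc' : l'.Pairwise (· ≤ ·)) (h : l.prod = l'.prod) : l = l' := by
  have aux : ∀ (a b : r.RIdeal) (t u : List r.RIdeal), b.Rad → (a :: t).Pairwise (· ≤ ·) →
      (a :: t).prod = (b :: u).prod → a ≤ b := by
    intro a b t u hb hat hprod
    refine hb.le_of_pow (n := (a :: t).length) (by simp) ?_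
    refine (pow_length_le_prod fun J hJ => ?_).trans (hprod.le.trans (prod_le_of_mem List.mem_cons_self))
    rcases List.mem_cons.1 hJ with rfl | hJ
    · exact le_rfl
    · exact List.rel_of_pairwise_cons hat hJ
  induction l generalizing l' with
  | nil =>
    cases l' with
    | nil => rfl
    | cons b u =>
      exact absurd (one_le_iff.1 (h.le.trans (prod_le_of_mem List.mem_cons_self)))
        (hl' b List.mem_cons_self).2
  | cons a t ih =>
    cases l' with
    | nil =>
      exact absurd (one_le_iff.1 (h.ge.trans (prod_le_of_mem List.mem_cons_self)))
        (hl a List.mem_cons_self).2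
    | cons b u =>
      have hab : a = b := le_antisymm (aux a b t u (hl' b List.mem_cons_self).1 hc h)
        (aux b a u t (hl a List.mem_cons_self).1 hc' h.symm)
      subst hab
      have hreg' : (a * u.prod).Reg := by rwa [h, List.prod_cons] at hreg
      rw [List.prod_cons] at hreg
      rw [List.prod_cons, List.prod_cons] at h
      have ht : t.prod.Reg := hreg.mono (mul_le_right _ _)
      rw [ih ht (fun J hJ => hl J (List.mem_cons_of_mem _ hJ))
        (fun J hJ => hl' J (List.mem_cons_of_mem _ hJ)) hc.of_cons hc'.of_cons
        (hcancel _ _ _ (hreg.mono (mul_le_left _ _)) ht (hreg'.mono (mul_le_right _ _)) h)]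

theorem IsUSCValuation.exists_chain (hv : IsUSCValuation v) {I : r.RIdeal} (hI : I.Reg) :
    ∃ l : List r.RIdeal, (∀ J ∈ l, J.Rad ∧ (1 : H) ∉ J) ∧ l.Pairwise (· ≤ ·) ∧ I = l.prod := by
  generalize hf : v I = f
  induction f using USCFun.induction_ind generalizing I with
  | h0 => exact ⟨[], by simp, List.Pairwise.nil, hv.inj hI reg_one (hf.trans hv.map_one.symm)⟩
  | h f hf0 ih =>
    obtain ⟨J, hJ, hJf⟩ := hv.surj f.ind
    obtain ⟨K, hK, hKf⟩ := hv.surj f.pred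
    obtain ⟨l, hl, hc, hKl⟩ := ih hK hKf
    have hIJK : I = J * K := hv.inj hI (hJ.mul hK) (by
      rw [hv.map_mul _ _ hJ hK, hJf, hKf, USCFun.ind_add_pred, hf])
    have hJrad : J.Rad := hv.rad hJ fun x => by
      rw [hJf, USCFun.ind_apply]; exact min_le_right _ _
    have hJone : (1 : H) ∉ J := fun h1 => hf0 <| USCFun.ext' fun x => by
      have h2 := (hv.le_iff _ _ reg_one hJ).1 (one_le_iff.2 h1) x
      rw [hJf, hv.map_one, USCFun.ind_apply, USCFun.zero_apply] at h2
      rw [USCFun.zero_apply]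
      omega
    refine ⟨J :: l, ?_, List.Pairwise.cons (fun L hL => ?_) hc, by rw [List.prod_cons, ← hKl, hIJK]⟩
    · rintro L hL
      rcases List.mem_cons.1 hL with rfl | hL
      · exact ⟨hJrad, hJone⟩
      · exact hl L hL
    · obtain ⟨n, hn⟩ := f.exists_bound
      -- With `f ≤ n`, the value `(n + 1) * min f 1` of `J ^ (n + 1)` dominates `f - 1`, so this
      -- power lies in `K ≤ L`. The extra one keeps the exponent positive.
      refine (hl L hL).1.le_of_pow n.succ_pos (le_trans ?_ (hKl.le.trans (prod_le_of_mem hL)))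
      refine (hv.le_iff _ _ (hJ.pow _) hK).2 fun x => ?_
      rw [hv.map_pow hJ, hJf, hKf, USCFun.ind_apply, USCFun.pred_apply]
      have := hn x
      rcases Nat.eq_zero_or_pos (f.1 x) with h0 | h0
      · omega
      · rw [min_eq_right h0]; omega

theorem IsUSCValuation.existsUnique_chain (hv : IsUSCValuation v) {I : r.RIdeal} (hI : I.Reg) :
    ∃! l : List r.RIdeal, (∀ J ∈ l, J.Rad ∧ (1 : H) ∉ J) ∧ l.Pairwise (· ≤ ·) ∧ I = l.prod := by
  obtain ⟨l, hl, hc, hIl⟩ := hv.exists_chain hI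
  refine ⟨l, ⟨hl, hc, hIl⟩, fun l' ⟨hl', hc', hIl'⟩ => ?_⟩
  exact eq_of_chain_prod_eq (fun _ _ _ => hv.cancel) (hIl' ▸ hI) hl' hl hc' hc (hIl'.symm.trans hIl)

end

/-! ### Passage between lists of sets and lists of `r`-ideals -/

theorem product_map_coe (l : List r.RIdeal) :
    r.product (l.map fun J : r.RIdeal => (J : Set H)) = (l.prod : r.RIdeal) := by
  induction l with
  | nil =>
    change r.cl {1} = Set.univ
    exact congrArg SetLike.coe (prin_one (r := r))
  | cons a t ih =>
    have ih' : r.cl (t.map fun J : r.RIdeal => (J : Set H)).prod = (t.prod : r.RIdeal) := ih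
    rw [product, List.map_cons, List.prod_cons, List.prod_cons, coe_mul, ← ih', r.cl_mul_cl]

theorem exists_map_coe {l : List (Set H)} (h : ∀ J ∈ l, r.IsIdeal J) :
    ∃ l' : List r.RIdeal, l'.map (fun J : r.RIdeal => (J : Set H)) = l := by
  induction l with
  | nil => exact ⟨[], rfl⟩
  | cons a t ih =>
    obtain ⟨t', ht⟩ := ih fun J hJ => h J (List.mem_cons_of_mem _ hJ)
    exact ⟨⟨a, h a List.mem_cons_self⟩ :: t', congrArg (a :: ·) ht⟩

theorem isProductOfRadicals_iff {I : r.RIdeal} :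
    r.IsProductOfRadicals (I : Set H) ↔ ∃ l : List r.RIdeal, (∀ J ∈ l, J.Rad) ∧ I = l.prod := by
  constructor
  · rintro ⟨l, hl, hIl⟩
    obtain ⟨l, rfl⟩ := exists_map_coe fun J hJ => (hl J hJ).1
    refine ⟨l, fun J hJ => rad_iff.2 (hl _ (List.mem_map_of_mem hJ)), SetLike.coe_injective ?_⟩
    rw [hIl, product_map_coe]
  · rintro ⟨l, hl, rfl⟩
    refine ⟨l.map fun J : r.RIdeal => (J : Set H), fun J hJ => ?_, (product_map_coe l).symm⟩
    obtain ⟨J, hJl, rfl⟩ := List.mem_map.1 hJ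
    exact rad_iff.1 (hl J hJl)

theorem isRadicalChainFactorization_map_coe {I : r.RIdeal} {l : List r.RIdeal} :
    r.IsRadicalChainFactorization (I : Set H) (l.map fun J : r.RIdeal => (J : Set H)) ↔
      (∀ J ∈ l, J.Rad ∧ (1 : H) ∉ J) ∧ l.Pairwise (· ≤ ·) ∧ I = l.prod := by
  rw [IsRadicalChainFactorization, List.forall_mem_map, List.pairwise_map, product_map_coe]
  simp only [← rad_iff, ne_one_iff]
  exact and_congr Iff.rfl (and_congr Iff.rfl SetLike.coe_injective.eq_iff)

theorem existsUnique_isRadicalChainFactorization {I : r.RIdeal}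
    (h : ∃! l : List r.RIdeal, (∀ J ∈ l, J.Rad ∧ (1 : H) ∉ J) ∧ l.Pairwise (· ≤ ·) ∧ I = l.prod) :
    ∃! l : List (Set H), r.IsRadicalChainFactorization (I : Set H) l := by
  obtain ⟨l, hl, huniq⟩ := h
  refine ⟨_, isRadicalChainFactorization_map_coe.2 hl, fun l' hl' => ?_⟩
  obtain ⟨l', rfl⟩ := exists_map_coe fun J hJ => (hl'.1 J hJ).1.1
  rw [huniq l' (isRadicalChainFactorization_map_coe.1 hl')]

end RIdeal

end WeakIdealSystem

/-! ### The equivalences -/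

open WeakIdealSystem RIdeal

theorem theorem8p4 {H : Type*} [CommMonoid H] (r : WeakIdealSystem H)
    (hne : r.cl ∅ ≠ Set.univ) (hmod : r.Modular) (hfin : r.Finitary)
    (hinv : ∀ I : Set H, r.IsIdeal I → r.IsRegularSet I → r.IsUnionOfInvertibles I) :
    List.TFAE [
      ∀ I : Set H, r.IsIdeal I → r.IsRegularSet I → r.IsProductOfRadicals I,
      (∀ P : Set H, r.IsPrimeIdeal P → r.IsRegularSet P → r.IsMaximalIdeal P) ∧
        ∀ I : Set H, r.IsIdeal I → r.IsInvertible I → r.IsProductOfRadicals I,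
      ∀ P : Set H, r.IsPrimeIdeal P → r.IsRegularSet P →
        r.IsMaximalIdeal P ∧ ∃ J ⊆ P, r.IsRadicalIdeal J ∧ r.IsInvertible J,
      ∀ I : Set H, r.IsIdeal I → r.IsRegularSet I →
        ∃! l : List (Set H), r.IsRadicalChainFactorization I l,
      ∀ I : Set H, r.IsIdeal I → r.IsRegularSet I → r.IsFinGen I →
        r.IsInvertible (WeakIdealSystem.radical I),
      ∃ e : r.RegLattice ≃o UbLattice r.RegMax,
        ∀ I J : r.RegLattice, e (I * J) = e I + e J,
      r.IsPruefer ∧ ∀ I : Set H, r.IsIdeal I → r.IsRegularSet I → r.IsFinGen I →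
        r.IsFinGen (WeakIdealSystem.radical I)] := by
  have hgen := genByInv_of_isUnionOfInvertibles hinv
  have prod_to_list (h : ∀ I : Set H, r.IsIdeal I → r.IsRegularSet I → r.IsProductOfRadicals I)
      (I : r.RIdeal) (hI : I.Reg) : ∃ l : List r.RIdeal, (∀ J ∈ l, J.Rad) ∧ I = l.prod :=
    isProductOfRadicals_iff.1 (h I I.2 hI)
  have good_of (h : ∀ P : Set H, r.IsPrimeIdeal P → r.IsRegularSet P →
        r.IsMaximalIdeal P ∧ ∃ J ⊆ P, r.IsRadicalIdeal J ∧ r.IsInvertible J) : PrimesGood r := by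
    intro P hP hreg
    obtain ⟨h1, J, hJP, hJ, hJi⟩ := h P (prim_iff.1 hP) hreg
    exact ⟨h1, ⟨J, hJ.1⟩, hJP, hJ.2, inv_iff.2 hJi⟩
  have of_good (h : PrimesGood r) : ∀ P : Set H, r.IsPrimeIdeal P → r.IsRegularSet P →
        r.IsMaximalIdeal P ∧ ∃ J ⊆ P, r.IsRadicalIdeal J ∧ r.IsInvertible J := by
    intro P hP hreg
    obtain ⟨h1, J, hJP, hJ, hJi⟩ := h ⟨P, hP.1⟩ (prim_iff.2 hP) hreg
    exact ⟨h1, J, hJP, rad_iff.1 hJ, inv_iff.1 hJi⟩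
  tfae_have 1 → 2 := fun h =>
    ⟨fun P hP hreg => (of_good (primesGood_of_prod_rad hfin hmod hgen (prod_to_list h)) P hP hreg).1,
      fun I hI hIi => h I hI (Inv.reg (I := ⟨I, hI⟩) (inv_iff.2 hIi))⟩
  tfae_have 2 → 3 := by
    rintro ⟨h1, h2⟩ P hP hreg
    refine ⟨h1 P hP hreg, ?_⟩
    -- A regular `y ∈ P` generates an invertible ideal; one of its radical factors lies in `P`, and
    -- factors of invertible ideals are invertible.
    obtain ⟨y, hyP, hy⟩ := hreg
    have hyi := inv_prin hy
    obtain ⟨l, hl, hyl⟩ := isProductOfRadicals_iff.1 (h2 _ (prin r y).2 (inv_iff.1 hyi))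
    have hlP : l.prod ≤ ⟨P, hP.1⟩ := hyl ▸ prin_le.2 hyP
    obtain ⟨J, hJl, hJP⟩ := (prim_iff.2 hP : Prim ⟨P, hP.1⟩).exists_mem_le hlP
    exact ⟨J, hJP, rad_iff.1 (hl J hJl), inv_iff.1 (Inv.of_mem_prod (hyl ▸ hyi) hJl)⟩
  tfae_have 3 → 6 := fun h => exists_orderIso hfin (good_of h) hgen hne
  tfae_have 6 → 4 := by
    rintro ⟨e, he⟩ I hI hreg
    obtain ⟨v, hv⟩ := exists_isUSCValuation hne e he
    exact existsUnique_isRadicalChainFactorization (I := ⟨I, hI⟩) (hv.existsUnique_chain hreg)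
  tfae_have 4 → 1 := by
    intro h I hI hreg
    obtain ⟨l, hl, -⟩ := h I hI hreg
    exact ⟨l, fun J hJ => (hl.1 J hJ).1, hl.2.2⟩
  tfae_have 3 → 7 := fun h =>
    ⟨fun I hI hreg hfg => inv_iff.1 (FG.inv hfin (good_of h) hgen (C := ⟨I,
      hI⟩) (fg_iff.2 hfg) hreg),
      fun I hI hreg hfg => fg_iff.1
        (FG.rad (hfin := hfin) (good_of h) hgen (I := ⟨I, hI⟩) (fg_iff.2 hfg) hreg)⟩
  tfae_have 7 → 5 := fun ⟨h1, h2⟩ I hI hreg hfg =>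
    h1 _ (rad hfin ⟨I, hI⟩).2 (Reg.mono (I := ⟨I, hI⟩) hreg (le_rad hfin _)) (h2 I hI hreg hfg)
  tfae_have 5 → 3 := fun h => of_good (primesGood_of_inv_rad hfin hgen fun I hI hfg =>
    inv_iff.2 (h I I.2 hI (fg_iff.1 hfg)))
  tfae_finish
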